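/- Let $M$ be a nonempty compact smooth Riemannian manifold without boundary, of dimension $n\ge 3$, and let $W\in C^3(\mathbb R)$ be a double-well potential: $W\ge 0$, and $W$ has exactly three critical points, namely two minima at $\pm1$ with $W(\pm1)=0$ and $W''(\pm1)>0$, and a local maximum $\gamma\in(-1,1)$. For $\varepsilon>0$ and $u\in H^1(M)=W^{1,2}(M)$ let $$E_\varepsilon(u)=\int_M \varepsilon\,\frac{|\nabla u|^2}{2}+\frac{W(u)}{\varepsilon}\ \in[0,\infty],$$ where $\nabla u$ is the weak gradient and the integral is with respect to the Riemannian volume, and let $$c_\varepsilon=\inf_{h\in\Gamma}\ \sup_{t\in[0,1]}E_\varepsilon(h(t)),$$ where $\Gamma$ is the set of continuous paths $h:[0,1]\to H^1(M)$ from the constant function $h(0)=-1$ to the constant function $h(1)=1$. Then $$0<\liminf_{\varepsilon\to0^+}c_\varepsilon\le\limsup_{\varepsilon\to0^+}c_\varepsilon<\infty.$$ -/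

import Mathlib

open MeasureTheory Set Filter Topology Manifold Bundle
open scoped ENNReal ContDiff

noncomputable section

namespace PhaseTransition

/-- `W` is a double-well potential: `W` is nonnegative, of class `C³`, with exactly three critical
points, namely non-degenerate minima with value `0` at `±1`, and a local maximum
`γ ∈ (-1, 1)`. -/
structure IsDoubleWell (W : ℝ → ℝ) : Prop where
  contDiff : ContDiff ℝ 3 W
  nonneg : ∀ s, 0 ≤ W s
  zero_one : W 1 = 0
  zero_neg_one : W (-1) = 0
  second_deriv_one : 0 < iteratedDeriv 2 W 1
  second_deriv_neg_one : 0 < iteratedDeriv 2 W (-1)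
  critical : ∃ γ ∈ Ioo (-1 : ℝ) 1, IsLocalMax W γ ∧ {s | deriv W s = 0} = {-1, γ, 1}

section Manifold

variable {n : ℕ} {M : Type*} [TopologicalSpace M] [ChartedSpace (EuclideanSpace ℝ (Fin n)) M]

/-- The tangent vector at `φ⁻¹(y)` with constant coordinates `v` in the chart `φ`, that is,
`d(φ⁻¹)_y v`. For `v = e_i` this is the coordinate vector field `∂_i`. -/
def coordVector (φ : OpenPartialHomeomorph M (EuclideanSpace ℝ (Fin n)))
    (v : EuclideanSpace ℝ (Fin n)) (y : EuclideanSpace ℝ (Fin n)) :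
    TangentSpace (𝓡 n) (φ.symm y) :=
  mfderiv (𝓡 n) (𝓡 n) φ.symm y v

variable [RiemannianBundle (fun x : M ↦ TangentSpace (𝓡 n) x)]

/-- The Riemannian volume density `√(det g_ij)` in the chart `φ`, where `g_ij = ⟨∂_i, ∂_j⟩`. -/
def chartDensity (φ : OpenPartialHomeomorph M (EuclideanSpace ℝ (Fin n)))
    (y : EuclideanSpace ℝ (Fin n)) : ℝ :=
  √(Matrix.det (Matrix.of fun i j : Fin n ↦
    inner ℝ (coordVector φ (EuclideanSpace.basisFun (Fin n) ℝ i) y)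
      (coordVector φ (EuclideanSpace.basisFun (Fin n) ℝ j) y)))

variable [MeasurableSpace M]

/-- The Riemannian volume on the domain of the chart `φ`, extended by zero:
`A ↦ ∫_{φ(A ∩ dom φ)} √(det g_ij) dy`. -/
def chartVolume (φ : OpenPartialHomeomorph M (EuclideanSpace ℝ (Fin n))) : Measure M :=
  ((volume.restrict φ.target).withDensity fun y ↦ ENNReal.ofReal (chartDensity φ y)).map φ.symm

variable (n M) in
/-- The Riemannian volume measure of `M`. By the change of variables formula the measures
`chartVolume φ` and `chartVolume φ'` agree on the intersection of the domains of `φ` and `φ'`; the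
least measure above all of them is the measure that restricts to `chartVolume φ` on the domain
of each chart `φ`. -/
def riemannianVolume : Measure M :=
  ⨆ φ ∈ atlas (EuclideanSpace ℝ (Fin n)) M, chartVolume φ

/-- The vector field `G` is the weak gradient of the function `u`: in each chart, the function
`u` has the weak partial derivatives `⟨G, ∂_i⟩`. -/
def IsWeakGradient (u : M → ℝ) (G : ∀ x : M, TangentSpace (𝓡 n) x) : Prop :=
  ∀ φ ∈ atlas (EuclideanSpace ℝ (Fin n)) M, ∀ η : EuclideanSpace ℝ (Fin n) → ℝ,
    ContDiff ℝ ∞ η → HasCompactSupport η → tsupport η ⊆ φ.target →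
    ∀ v : EuclideanSpace ℝ (Fin n),
      ∫ y, u (φ.symm y) * fderiv ℝ η y v =
        -∫ y, inner ℝ (G (φ.symm y)) (coordVector φ v y) * η y

variable (n M) in
/-- An element of the Sobolev space `H¹(M) = W^{1,2}(M)`, given by a representative `toFun` in
`L²(M)` together with a representative `grad` of its weak gradient, which is a measurable vector
field (its components in each chart are measurable) of finite `L²` norm. Both are
determined up to null sets by the element, and everything below only depends on them
up to null sets. -/
structure H1 where
  toFun : M → ℝ
  grad : ∀ x : M, TangentSpace (𝓡 n) x
  memLp : MemLp toFun 2 (riemannianVolume n M)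
  aemeasurable_grad : ∀ φ ∈ atlas (EuclideanSpace ℝ (Fin n)) M,
    ∀ v : EuclideanSpace ℝ (Fin n),
      AEMeasurable (fun y ↦ (inner ℝ (grad (φ.symm y)) (coordVector φ v y) : ℝ))
        (volume.restrict φ.target)
  lintegral_grad : ∫⁻ x, ENNReal.ofReal (‖grad x‖ ^ 2) ∂(riemannianVolume n M) < ⊤
  isWeakGradient : IsWeakGradient toFun grad

/-- The distance `‖u - v‖_{H¹} = (∫ |u - v|² + |∇u - ∇v|²)^{1/2}`. -/
def H1.distance (u v : H1 n M) : ℝ≥0∞ :=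
  (∫⁻ x, ENNReal.ofReal ((u.toFun x - v.toFun x) ^ 2 + ‖u.grad x - v.grad x‖ ^ 2)
    ∂(riemannianVolume n M)) ^ (1 / 2 : ℝ)

/-- The Allen-Cahn energy `E_ε(u) = ∫_M ε |∇u|² / 2 + W(u) / ε`. For `W ≥ 0` and `ε > 0` the
integrand is nonnegative; the value `⊤` occurs if `W ∘ u` is not integrable. -/
def energy (W : ℝ → ℝ) (ε : ℝ) (u : H1 n M) : ℝ≥0∞ :=
  ∫⁻ x, ENNReal.ofReal (ε * (‖u.grad x‖ ^ 2 / 2) + W (u.toFun x) / ε) ∂(riemannianVolume n M)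

variable (n M) in
/-- The set `Γ` of continuous paths `h : [0, 1] → H¹(M)` that join the constant functions
`-1` and `1`. -/
def paths : Set (unitInterval → H1 n M) :=
  {h | (∀ s, Tendsto (fun t ↦ (h t).distance (h s)) (𝓝 s) (𝓝 0)) ∧
    (∀ᵐ x ∂(riemannianVolume n M), (h 0).toFun x = -1) ∧
    (∀ᵐ x ∂(riemannianVolume n M), (h 1).toFun x = 1)}

variable (n M) in
/-- The min-max value `c_ε = inf_{h ∈ Γ} sup_{t ∈ [0, 1]} E_ε(h(t))`. -/
def minMaxValue (W : ℝ → ℝ) (ε : ℝ) : ℝ≥0∞ :=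
  ⨅ h ∈ paths n M, ⨆ t : unitInterval, energy W ε (h t)

end Manifold

end PhaseTransition

end

set_option linter.unusedSectionVars false

/-! Lower bound. Fix one coordinate ball `B`. The functional `u ↦ ∫_B smoothStep u` is continuous on
`H¹`, is nonpositive at the start of a path in `Γ` and nonnegative at its end, so it vanishes at
some function `u` of the path (`exists_integral_eq_zero`). Such a balanced `u` must pay for a
transition. By the chain rule and Young's inequality, `|∇(smoothStep ∘ u)|` is at most a constant
times `ε |∇u|² + plateau u / ε` (Modica–Mortola). The Poincaré inequality in `L¹` turns this into a
bound for `∫_B |smoothStep u|`. Where `plateau u` is small, `u` is away from the transition region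
and `|smoothStep u|` is close to `1/2`. Hence either `∫_B plateau u` or the gradient bound is large,
and `ε ≤ 1` gives a lower bound independent of `ε` (`exists_le_energy_of_integral_eq_zero`). The
Poincaré inequality is proved for `C¹` functions and reaches `H¹` by mollification. The potential
enters only through `a * plateau ≤ W`.

Upper bound. By compactness, finitely many smooth functions `ρ_k ≥ 0` have sublevel sets `{ρ_k ≤ 1}`
covering `M`, and below level `2` the volume between two levels of `ρ_k` is at most linear in their
difference (`exists_sweep_function`). The competitor at time `t` is `1` where some `ρ_k ≤ 2t - ε`
and `-1` where all `ρ_k ≥ 2t`. It fails to be locally constant only in layers of total volume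
`O(ε)`, in which the energy density is `O(1/ε)`; so the energy is bounded uniformly in `t` and `ε`
(`energy_sweepPath_le`). -/

noncomputable section

namespace PhaseTransition

/-! ### Coordinate vector fields, metric coefficients and volume density in charts. -/

section Charts
variable {n : ℕ} {M : Type*} [TopologicalSpace M] [ChartedSpace (EuclideanSpace ℝ (Fin n)) M]
  {φ φ' : OpenPartialHomeomorph M (EuclideanSpace ℝ (Fin n))}

instance finiteDimensional_tangentSpace (x : M) : FiniteDimensional ℝ (TangentSpace (𝓡 n) x) :=
  inferInstanceAs (FiniteDimensional ℝ (EuclideanSpace ℝ (Fin n)))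

/-- The linear map `v ↦ d(φ⁻¹)_y v`. -/
def coordLinearMap (φ : OpenPartialHomeomorph M (EuclideanSpace ℝ (Fin n)))
    (y : EuclideanSpace ℝ (Fin n)) :
    EuclideanSpace ℝ (Fin n) →ₗ[ℝ] TangentSpace (𝓡 n) (φ.symm y) :=
  (mfderiv (𝓡 n) (𝓡 n) φ.symm y).toLinearMap

lemma coordLinearMap_apply (v y : EuclideanSpace ℝ (Fin n)) :
    coordLinearMap φ y v = coordVector φ v y := rfl

section Smooth

variable [IsManifold (𝓡 n) ∞ M]

lemma mdifferentiableAt_symm (hφ : φ ∈ atlas (EuclideanSpace ℝ (Fin n)) M)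
    {y : EuclideanSpace ℝ (Fin n)} (hy : y ∈ φ.target) :
    MDifferentiableAt (𝓡 n) (𝓡 n) φ.symm y :=
  haveI : IsManifold (𝓡 n) 1 M := IsManifold.of_le (n := ∞) (by norm_num)
  (mdifferentiable_of_mem_atlas (I := 𝓡 n) hφ).mdifferentiableAt_symm hy

lemma continuousOn_coordVector (hφ : φ ∈ atlas (EuclideanSpace ℝ (Fin n)) M)
    (v : EuclideanSpace ℝ (Fin n)) :
    ContinuousOn (fun y ↦ (⟨φ.symm y, coordVector φ v y⟩ : TangentBundle (𝓡 n) M)) φ.target := by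
  have h1 : ContMDiffOn (𝓡 n) (𝓡 n) ∞ φ.symm φ.target :=
    contMDiffOn_symm_of_mem_maximalAtlas (IsManifold.subset_maximalAtlas hφ)
  have h2 := h1.continuousOn_tangentMapWithin (by norm_num) φ.open_target.uniqueMDiffOn
  have h3 : Continuous (fun y : EuclideanSpace ℝ (Fin n) ↦
      (⟨y, v⟩ : TangentBundle (𝓡 n) (EuclideanSpace ℝ (Fin n)))) :=
    (tangentBundleModelSpaceHomeomorph (𝓡 n)).symm.continuous.comp
      (Continuous.prodMk continuous_id continuous_const)
  refine (h2.comp h3.continuousOn (fun y hy ↦ hy)).congr fun y hy ↦ ?_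
  simp [tangentMapWithin, coordVector, mfderivWithin_of_isOpen φ.open_target hy]

/-- The transition map `φ ∘ φ'⁻¹` is smooth where it is defined. -/
lemma contDiffAt_transition (hφ : φ ∈ atlas (EuclideanSpace ℝ (Fin n)) M)
    (hφ' : φ' ∈ atlas (EuclideanSpace ℝ (Fin n)) M) {y : EuclideanSpace ℝ (Fin n)}
    (hy : y ∈ φ'.target) (hy' : φ'.symm y ∈ φ.source) :
    ContDiffAt ℝ ∞ (φ ∘ φ'.symm) y := by
  have h1 : ContMDiffAt (𝓡 n) (𝓡 n) ∞ φ (φ'.symm y) :=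
    contMDiffAt_of_mem_maximalAtlas (IsManifold.subset_maximalAtlas hφ) hy'
  have h2 : ContMDiffAt (𝓡 n) (𝓡 n) ∞ φ'.symm y :=
    contMDiffAt_symm_of_mem_maximalAtlas (IsManifold.subset_maximalAtlas hφ') hy
  exact (h1.comp y h2).contDiffAt

lemma injective_coordVector (hφ : φ ∈ atlas (EuclideanSpace ℝ (Fin n)) M)
    {y : EuclideanSpace ℝ (Fin n)} (hy : y ∈ φ.target) :
    Function.Injective (fun v ↦ coordVector φ v y) := by
  have : IsManifold (𝓡 n) 1 M := IsManifold.of_le (n := ∞) (by norm_num)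
  have h := (mdifferentiable_of_mem_atlas (I := 𝓡 n) hφ).symm
  exact (h.mfderiv (x := y) hy).injective

end Smooth

section Metric

variable [RiemannianBundle (fun x : M ↦ TangentSpace (𝓡 n) x)]

/-- The inner product at the point `x` of two tangent vectors given as elements of the model
space. -/
def tangentInner (x : M) (v w : EuclideanSpace ℝ (Fin n)) : ℝ :=
  inner ℝ (E := TangentSpace (𝓡 n) x) v w

/-- The metric coefficients `⟨∂_v, ∂_w⟩` in the chart `φ`. -/
def metricCoeff (φ : OpenPartialHomeomorph M (EuclideanSpace ℝ (Fin n)))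
    (y v w : EuclideanSpace ℝ (Fin n)) : ℝ :=
  inner ℝ (coordVector φ v y) (coordVector φ w y)

/-- The Gram matrix of the coordinate vector fields of the chart `φ`. -/
def gram (φ : OpenPartialHomeomorph M (EuclideanSpace ℝ (Fin n)))
    (y : EuclideanSpace ℝ (Fin n)) : Matrix (Fin n) (Fin n) ℝ :=
  Matrix.of fun i j ↦ metricCoeff φ y (EuclideanSpace.basisFun (Fin n) ℝ i)
    (EuclideanSpace.basisFun (Fin n) ℝ j)

lemma chartDensity_eq_sqrt_det_gram (y : EuclideanSpace ℝ (Fin n)) :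
    chartDensity φ y = √(gram φ y).det := rfl

lemma metricCoeff_sum_sum (y : EuclideanSpace ℝ (Fin n)) {ι : Type*}
    (s : Finset ι) (e f : ι → EuclideanSpace ℝ (Fin n)) (a b : ι → ℝ) :
    metricCoeff φ y (∑ i ∈ s, a i • e i) (∑ j ∈ s, b j • f j) =
      ∑ i ∈ s, ∑ j ∈ s, a i * b j * metricCoeff φ y (e i) (f j) := by
  have h : ∀ (c : ι → ℝ) (g : ι → EuclideanSpace ℝ (Fin n)),
      coordVector φ (∑ i ∈ s, c i • g i) y = ∑ i ∈ s, c i • coordVector φ (g i) y := by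
    intro c g
    simp only [← coordLinearMap_apply, map_sum, map_smul]
  unfold metricCoeff
  rw [h, h, sum_inner]
  refine Finset.sum_congr rfl fun i _ ↦ ?_
  rw [inner_sum]
  refine Finset.sum_congr rfl fun j _ ↦ ?_
  rw [real_inner_smul_left, real_inner_smul_right]
  ring

variable [IsManifold (𝓡 n) ∞ M]

lemma metricCoeff_transition (hφ : φ ∈ atlas (EuclideanSpace ℝ (Fin n)) M)
    (hφ' : φ' ∈ atlas (EuclideanSpace ℝ (Fin n)) M) {y : EuclideanSpace ℝ (Fin n)}
    (hy : y ∈ φ'.target) (hy' : φ'.symm y ∈ φ.source) (v w : EuclideanSpace ℝ (Fin n)) :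
    metricCoeff φ' y v w = metricCoeff φ (φ (φ'.symm y)) (fderiv ℝ (φ ∘ φ'.symm) y v)
      (fderiv ℝ (φ ∘ φ'.symm) y w) := by
  have key : ∀ v : EuclideanSpace ℝ (Fin n), (coordVector φ' v y : EuclideanSpace ℝ (Fin n)) =
      coordVector φ (fderiv ℝ (φ ∘ φ'.symm) y v) (φ (φ'.symm y)) := by
    intro v
    have h1 : MDifferentiableAt (𝓡 n) (𝓡 n) φ.symm ((φ ∘ φ'.symm) y) :=
      mdifferentiableAt_symm hφ (φ.map_source hy')
    have h2 : MDifferentiableAt (𝓡 n) (𝓡 n) (φ ∘ φ'.symm) y :=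
      ((contDiffAt_transition hφ hφ' hy hy').differentiableAt (by simp)).mdifferentiableAt
    have h3 := mfderiv_comp y h1 h2
    have h4 : φ.symm ∘ (φ ∘ φ'.symm) =ᶠ[𝓝 y] φ'.symm := by
      have : φ'.symm ⁻¹' φ.source ∈ 𝓝 y :=
        (φ'.continuousAt_symm hy).preimage_mem_nhds (φ.open_source.mem_nhds hy')
      filter_upwards [this] with z hz
      exact φ.left_inv hz
    have h5 := h4.mfderiv_eq (I := 𝓡 n) (I' := 𝓡 n)
    unfold coordVector
    have h6 := h3.symm.trans h5
    rw [mfderiv_eq_fderiv] at h6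
    exact (DFunLike.congr_fun h6 v).symm
  -- The two base points are equal but not definitionally so, and the inner product depends on the
  -- base point. `tangentInner` takes vectors of the model space, so the base point can be
  -- rewritten.
  have h0 : φ.symm (φ (φ'.symm y)) = φ'.symm y := φ.left_inv hy'
  calc metricCoeff φ' y v w
      = tangentInner (φ'.symm y) (coordVector φ' v y) (coordVector φ' w y) := rfl
    _ = tangentInner (φ.symm (φ (φ'.symm y)))
          (coordVector φ (fderiv ℝ (φ ∘ φ'.symm) y v) (φ (φ'.symm y)))
          (coordVector φ (fderiv ℝ (φ ∘ φ'.symm) y w) (φ (φ'.symm y))) := by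
        rw [h0]
        exact congrArg₂ (tangentInner (φ'.symm y)) (key v) (key w)
    _ = _ := rfl

/-- The Gram matrices are congruent through the Jacobian matrix `A` of the transition map, `G' = Aᵀ
G A`, so the root of the determinant picks up `|det A|`. This is the factor in the change of
variables formula. -/
lemma gram_transition (hφ : φ ∈ atlas (EuclideanSpace ℝ (Fin n)) M)
    (hφ' : φ' ∈ atlas (EuclideanSpace ℝ (Fin n)) M) {y : EuclideanSpace ℝ (Fin n)}
    (hy : y ∈ φ'.target) (hy' : φ'.symm y ∈ φ.source) :
    chartDensity φ' y =
      |(fderiv ℝ (φ ∘ φ'.symm) y).det| * chartDensity φ (φ (φ'.symm y)) := by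
  set D := fderiv ℝ (φ ∘ φ'.symm) y
  set b := EuclideanSpace.basisFun (Fin n) ℝ
  set A : Matrix (Fin n) (Fin n) ℝ := LinearMap.toMatrix b.toBasis b.toBasis D
  have hD : ∀ i, D (b i) = ∑ k, A k i • b k := by
    intro i
    rw [← b.sum_repr (D (b i))]
    refine Finset.sum_congr rfl fun k _ ↦ ?_
    simp [A, LinearMap.toMatrix_apply]
  have h : gram φ' y = A.transpose * gram φ (φ (φ'.symm y)) * A := by
    ext i j
    rw [gram, Matrix.of_apply, metricCoeff_transition hφ hφ' hy hy']
    change metricCoeff φ _ (D (b i)) (D (b j)) = _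
    rw [hD, hD, metricCoeff_sum_sum]
    simp only [Matrix.mul_apply, Matrix.transpose_apply, gram, Matrix.of_apply, Finset.sum_mul]
    rw [Finset.sum_comm]
    refine Finset.sum_congr rfl fun k _ ↦ Finset.sum_congr rfl fun l _ ↦ ?_
    change A l i * A k j * _ = A l i * _ * A k j
    ring
  have hdet : A.det = D.det := by
    rw [ContinuousLinearMap.det, ← LinearMap.det_toMatrix b.toBasis]
  rw [chartDensity_eq_sqrt_det_gram, chartDensity_eq_sqrt_det_gram, h, Matrix.det_mul,
    Matrix.det_mul, Matrix.det_transpose, hdet, mul_right_comm, ← sq, Real.sqrt_mul (sq_nonneg _),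
    Real.sqrt_sq_eq_abs]

lemma chartDensity_pos (hφ : φ ∈ atlas (EuclideanSpace ℝ (Fin n)) M)
    {y : EuclideanSpace ℝ (Fin n)} (hy : y ∈ φ.target) : 0 < chartDensity φ y := by
  rw [chartDensity_eq_sqrt_det_gram, Real.sqrt_pos]
  refine Matrix.PosDef.det_pos ?_
  have hli : LinearIndependent ℝ
      (fun i ↦ coordVector φ (EuclideanSpace.basisFun (Fin n) ℝ i) y) := by
    have h1 := (EuclideanSpace.basisFun (Fin n) ℝ).toBasis.linearIndependent
    have h2 := h1.map' (coordLinearMap φ y)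
      (LinearMap.ker_eq_bot.2 (injective_coordVector hφ hy))
    rw [OrthonormalBasis.coe_toBasis] at h2
    exact h2
  exact Matrix.posDef_gram_of_linearIndependent hli

variable [IsContMDiffRiemannianBundle (𝓡 n) ∞ (EuclideanSpace ℝ (Fin n))
      (fun x : M ↦ TangentSpace (𝓡 n) x)]

lemma continuousOn_metricCoeff (hφ : φ ∈ atlas (EuclideanSpace ℝ (Fin n)) M)
    (v w : EuclideanSpace ℝ (Fin n)) :
    ContinuousOn (fun y ↦ metricCoeff φ y v w) φ.target := by
  have : IsContinuousRiemannianBundle (EuclideanSpace ℝ (Fin n))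
      (fun x : M ↦ TangentSpace (𝓡 n) x) := by
    obtain ⟨g, hg, h⟩ := IsContMDiffRiemannianBundle.exists_contMDiff (IB := 𝓡 n) (n := ∞)
      (F := EuclideanSpace ℝ (Fin n)) (E := fun x : M ↦ TangentSpace (𝓡 n) x)
    exact ⟨g, hg.continuous, h⟩
  exact ContinuousOn.inner_bundle (continuousOn_coordVector hφ v) (continuousOn_coordVector hφ w)

lemma continuousOn_chartDensity (hφ : φ ∈ atlas (EuclideanSpace ℝ (Fin n)) M) :
    ContinuousOn (chartDensity φ) φ.target := by
  have h : ContinuousOn (gram φ) φ.target :=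
    continuousOn_pi.2 fun i ↦ continuousOn_pi.2 fun j ↦ continuousOn_metricCoeff hφ _ _
  exact Real.continuous_sqrt.comp_continuousOn
    (Continuous.matrix_det continuous_id |>.comp_continuousOn h)

end Metric
end Charts

/-! ### The Riemannian volume compared with Lebesgue measure in a chart. -/

section Volume
variable {n : ℕ} {M : Type*} [TopologicalSpace M] [ChartedSpace (EuclideanSpace ℝ (Fin n)) M]
  [IsManifold (𝓡 n) ∞ M]
  [RiemannianBundle (fun x : M ↦ TangentSpace (𝓡 n) x)]
  [IsContMDiffRiemannianBundle (𝓡 n) ∞ (EuclideanSpace ℝ (Fin n))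
      (fun x : M ↦ TangentSpace (𝓡 n) x)]
  [MeasurableSpace M] [BorelSpace M]
  {φ φ' : OpenPartialHomeomorph M (EuclideanSpace ℝ (Fin n))}

/-- The measure `√(det g_ij) dy` on the target of the chart `φ`. -/
def coordVolume (φ : OpenPartialHomeomorph M (EuclideanSpace ℝ (Fin n))) :
    Measure (EuclideanSpace ℝ (Fin n)) :=
  (volume.restrict φ.target).withDensity fun y ↦ ENNReal.ofReal (chartDensity φ y)

omit [MeasurableSpace M] [BorelSpace M] in
lemma aemeasurable_chartDensity (hφ : φ ∈ atlas (EuclideanSpace ℝ (Fin n)) M) :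
    AEMeasurable (fun y ↦ ENNReal.ofReal (chartDensity φ y)) (volume.restrict φ.target) :=
  ((continuousOn_chartDensity hφ).aemeasurable φ.open_target.measurableSet).ennreal_ofReal

omit [IsManifold (𝓡 n) ∞ M] [IsContMDiffRiemannianBundle (𝓡 n) ∞ (EuclideanSpace ℝ (Fin n))
      (fun x : M ↦ TangentSpace (𝓡 n) x)] in
lemma aemeasurable_symm : AEMeasurable φ.symm (coordVolume φ) :=
  (φ.continuousOn_symm.aemeasurable φ.open_target.measurableSet).mono_ac
    (withDensity_absolutelyContinuous _ _)

omit [IsManifold (𝓡 n) ∞ M] [IsContMDiffRiemannianBundle (𝓡 n) ∞ (EuclideanSpace ℝ (Fin n))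
      (fun x : M ↦ TangentSpace (𝓡 n) x)] in
lemma chartVolume_apply {S : Set M} (hS : MeasurableSet S) :
    chartVolume φ S =
      ∫⁻ y in φ.symm ⁻¹' S ∩ φ.target, ENNReal.ofReal (chartDensity φ y) := by
  change (coordVolume φ).map φ.symm S = _
  rw [Measure.map_apply_of_aemeasurable aemeasurable_symm hS, coordVolume, withDensity_apply',
    Measure.restrict_restrict' φ.open_target.measurableSet]

omit [IsManifold (𝓡 n) ∞ M] [RiemannianBundle (fun x : M ↦ TangentSpace (𝓡 n) x)]
  [IsContMDiffRiemannianBundle (𝓡 n) ∞ (EuclideanSpace ℝ (Fin n))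
      (fun x : M ↦ TangentSpace (𝓡 n) x)] in
lemma measurableSet_preimage_symm {S : Set M} (hS : MeasurableSet S) :
    MeasurableSet (φ.symm ⁻¹' S ∩ φ.target) := by
  have h := (continuousOn_iff_continuous_domRestrict.1 φ.continuousOn_symm).measurable hS
  have h' := φ.open_target.measurableSet.subtype_image h
  convert h' using 1
  ext y
  simp [and_comm]

/-- Change of variables under `φ ∘ φ'⁻¹`. Only an inequality can hold, because `S` may stick out of
the domain of `φ'`. -/
lemma chartVolume_le_chartVolume (hφ : φ ∈ atlas (EuclideanSpace ℝ (Fin n)) M)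
    (hφ' : φ' ∈ atlas (EuclideanSpace ℝ (Fin n)) M) {S : Set M} (hS : MeasurableSet S)
    (hSφ : S ⊆ φ.source) : chartVolume φ' S ≤ chartVolume φ S := by
  rw [chartVolume_apply hS, chartVolume_apply hS]
  have hinj : InjOn (φ ∘ φ'.symm) (φ'.symm ⁻¹' S ∩ φ'.target) := by
    intro y hy z hz h
    exact φ'.symm.injOn hy.2 hz.2 (φ.injOn (hSφ hy.1) (hSφ hz.1) h)
  have hderiv : ∀ y ∈ φ'.symm ⁻¹' S ∩ φ'.target, HasFDerivWithinAt (φ ∘ φ'.symm)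
      (fderiv ℝ (φ ∘ φ'.symm) y) (φ'.symm ⁻¹' S ∩ φ'.target) y := fun y hy ↦
    ((contDiffAt_transition hφ hφ' hy.2 (hSφ hy.1)).differentiableAt
      (by simp)).hasFDerivAt.hasFDerivWithinAt
  have hsub : (φ ∘ φ'.symm) '' (φ'.symm ⁻¹' S ∩ φ'.target) ⊆ φ.symm ⁻¹' S ∩ φ.target := by
    rintro _ ⟨y, hy, rfl⟩
    refine ⟨?_, φ.map_source (hSφ hy.1)⟩
    simpa [φ.left_inv (hSφ hy.1)] using hy.1
  refine le_trans (le_of_eq ?_) (lintegral_mono_set hsub)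
  rw [lintegral_image_eq_lintegral_abs_det_fderiv_mul volume (measurableSet_preimage_symm hS)
    hderiv hinj]
  refine setLIntegral_congr_fun (measurableSet_preimage_symm hS) fun y hy ↦ ?_
  rw [gram_transition hφ hφ' hy.2 (hSφ hy.1), ENNReal.ofReal_mul (abs_nonneg _)]
  rfl

omit [IsManifold (𝓡 n) ∞ M] [IsContMDiffRiemannianBundle (𝓡 n) ∞ (EuclideanSpace ℝ (Fin n))
      (fun x : M ↦ TangentSpace (𝓡 n) x)] [BorelSpace M] in
lemma chartVolume_le_riemannianVolume (hφ : φ ∈ atlas (EuclideanSpace ℝ (Fin n)) M) :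
    chartVolume φ ≤ riemannianVolume n M :=
  le_iSup₂ (f := fun φ (_ : φ ∈ atlas (EuclideanSpace ℝ (Fin n)) M) ↦ chartVolume φ) φ hφ

lemma riemannianVolume_le_chartVolume (hφ : φ ∈ atlas (EuclideanSpace ℝ (Fin n)) M)
    {S : Set M} (hS : MeasurableSet S) (hSφ : S ⊆ φ.source) :
    riemannianVolume n M S ≤ chartVolume φ S := by
  set μ := riemannianVolume n M
  -- A supremum of measures lies below every common upper bound. This bound adds nothing to
  -- `chartVolume φ` on subsets of the domain of `φ`.
  have h : μ ≤ chartVolume φ + μ.restrict φ.sourceᶜ := by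
    refine iSup₂_le fun φ' hφ' ↦ ?_
    rw [Measure.le_iff]
    intro T hT
    rw [← measure_inter_add_sdiff T φ.open_source.measurableSet, Measure.add_apply,
      Measure.restrict_apply hT]
    refine add_le_add ?_ ?_
    · exact (chartVolume_le_chartVolume hφ hφ' (hT.inter φ.open_source.measurableSet)
        inter_subset_right).trans (measure_mono inter_subset_left)
    · exact chartVolume_le_riemannianVolume hφ' _
  refine (h S).trans ?_
  rw [Measure.add_apply, Measure.restrict_apply hS,
    (disjoint_compl_right_iff_subset.2 hSφ).inter_eq]
  simp

/-- A set whose coordinates in the chart `φ` lie in `K`, where the volume density is at most `C`,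
has volume at most `C |K|`. -/
lemma riemannianVolume_le_mul_volume (hφ : φ ∈ atlas (EuclideanSpace ℝ (Fin n)) M)
    {S : Set M} (hS : MeasurableSet S) (hSφ : S ⊆ φ.source) {K : Set (EuclideanSpace ℝ (Fin n))}
    (hSK : ∀ x ∈ S, φ x ∈ K) {C : ℝ} (hC : ∀ y ∈ φ.target ∩ φ.symm ⁻¹' S, chartDensity φ y ≤ C) :
    riemannianVolume n M S ≤ ENNReal.ofReal C * volume K := by
  refine (riemannianVolume_le_chartVolume hφ hS hSφ).trans ?_
  rw [chartVolume_apply hS]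
  calc ∫⁻ y in φ.symm ⁻¹' S ∩ φ.target, ENNReal.ofReal (chartDensity φ y)
      ≤ ∫⁻ y in φ.symm ⁻¹' S ∩ φ.target, ENNReal.ofReal C :=
        setLIntegral_mono' (measurableSet_preimage_symm hS) fun y hy ↦
          ENNReal.ofReal_le_ofReal (hC y hy.symm)
    _ = ENNReal.ofReal C * volume (φ.symm ⁻¹' S ∩ φ.target) := by simp
    _ ≤ _ := by
      gcongr
      intro y hy
      simpa [φ.right_inv hy.2] using hSK _ hy.1

lemma riemannianVolume_finiteAt_nhds (x : M) : (riemannianVolume n M).FiniteAtFilter (𝓝 x) := by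
  set φ := chartAt (EuclideanSpace ℝ (Fin n)) x
  have hφ : φ ∈ atlas (EuclideanSpace ℝ (Fin n)) M := chart_mem_atlas _ x
  have hx : x ∈ φ.source := mem_chart_source _ x
  have hc := (continuousOn_chartDensity hφ).continuousAt
    (φ.open_target.mem_nhds (φ.map_source hx))
  obtain ⟨U, hU, hUo, hxU⟩ := eventually_nhds_iff.1
    (hc.eventually_lt_const (lt_add_one (chartDensity φ (φ x))))
  have hopen : IsOpen (φ.source ∩ φ ⁻¹' (U ∩ Metric.ball (φ x) 1)) :=
    φ.continuousOn.isOpen_inter_preimage φ.open_source (hUo.inter Metric.isOpen_ball)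
  refine ⟨_, hopen.mem_nhds ⟨hx, hxU, Metric.mem_ball_self one_pos⟩, ?_⟩
  refine (riemannianVolume_le_mul_volume hφ hopen.measurableSet inter_subset_left
    (K := Metric.ball (φ x) 1) (fun y hy ↦ hy.2.2) (C := chartDensity φ (φ x) + 1) ?_).trans_lt ?_
  · rintro y ⟨hy, hy'⟩
    have := hy'.2.1
    rw [φ.right_inv hy] at this
    exact (hU y this).le
  · exact ENNReal.mul_lt_top ENNReal.ofReal_lt_top measure_ball_lt_top

instance isFiniteMeasure_riemannianVolume [CompactSpace M] :
    IsFiniteMeasure (riemannianVolume n M) :=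
  ⟨isCompact_univ.measure_lt_top_of_nhdsWithin fun x _ ↦ by
    rw [nhdsWithin_univ]; exact riemannianVolume_finiteAt_nhds x⟩

lemma absolutelyContinuous_coordVolume (hφ : φ ∈ atlas (EuclideanSpace ℝ (Fin n)) M) :
    volume.restrict φ.target ≪ coordVolume φ := by
  refine withDensity_absolutelyContinuous' (aemeasurable_chartDensity hφ) ?_
  filter_upwards [ae_restrict_mem φ.open_target.measurableSet] with y hy
  simpa using chartDensity_pos hφ hy

lemma ae_comp_symm (hφ : φ ∈ atlas (EuclideanSpace ℝ (Fin n)) M) {P : M → Prop}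
    (h : ∀ᵐ x ∂riemannianVolume n M, P x) : ∀ᵐ y ∂volume.restrict φ.target, P (φ.symm y) :=
  absolutelyContinuous_coordVolume hφ (ae_of_ae_map aemeasurable_symm
    ((Measure.absolutelyContinuous_of_le (chartVolume_le_riemannianVolume hφ)) h))

lemma aestronglyMeasurable_comp_symm (hφ : φ ∈ atlas (EuclideanSpace ℝ (Fin n)) M) {u : M → ℝ}
    (h : AEStronglyMeasurable u (riemannianVolume n M)) :
    AEStronglyMeasurable (fun y ↦ u (φ.symm y)) (volume.restrict φ.target) :=
  ((h.mono_measure (chartVolume_le_riemannianVolume hφ)).comp_aemeasurable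
    aemeasurable_symm).mono_ac (absolutelyContinuous_coordVolume hφ)

/-- The integral of a function on `M` is bounded below by the integral of any measurable
minorant in the chart `φ`. -/
lemma lintegral_coord_le (hφ : φ ∈ atlas (EuclideanSpace ℝ (Fin n)) M)
    {A : Set (EuclideanSpace ℝ (Fin n))} (hA : MeasurableSet A) (hAφ : A ⊆ φ.target)
    {k : EuclideanSpace ℝ (Fin n) → ℝ≥0∞} (hk : AEMeasurable k (volume.restrict A))
    {f : M → ℝ≥0∞} (hkf : ∀ y ∈ A, k y ≤ f (φ.symm y)) {c : ℝ}
    (hc : ∀ y ∈ A, c ≤ chartDensity φ y) :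
    ENNReal.ofReal c * ∫⁻ y in A, k y ≤ ∫⁻ x, f x ∂riemannianVolume n M := by
  -- `f` is not assumed measurable, so it cannot be pulled back through the image measure directly.
  -- A measurable minorant `g` of `k` with the same integral is moved to `M` instead and extended by
  -- zero.
  obtain ⟨g, hg, hgk, hgint⟩ := exists_measurable_le_lintegral_eq (coordVolume φ) (A.indicator k)
  classical
  set Φ : M → EuclideanSpace ℝ (Fin n) := φ.source.piecewise φ (fun _ ↦ 0)
  have hΦ : Measurable Φ := φ.continuousOn.measurable_piecewise continuousOn_const
    φ.open_source.measurableSet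
  set F : M → ℝ≥0∞ := φ.source.indicator (g ∘ Φ)
  have hF : Measurable F := (hg.comp hΦ).indicator φ.open_source.measurableSet
  have hFf : F ≤ f := by
    intro x
    by_cases hx : x ∈ φ.source
    · have h1 : F x = g (φ x) := by simp [F, Φ, hx]
      rw [h1]
      refine (hgk _).trans ?_
      by_cases hxA : φ x ∈ A
      · rw [indicator_of_mem hxA]
        simpa [φ.left_inv hx] using hkf _ hxA
      · simp [hxA]
    · simp [F, hx]
  have hrestr : (coordVolume φ).restrict A =
      (volume.restrict A).withDensity fun y ↦ ENNReal.ofReal (chartDensity φ y) := by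
    rw [coordVolume, restrict_withDensity hA, Measure.restrict_restrict hA,
      inter_eq_self_of_subset_left hAφ]
  calc ENNReal.ofReal c * ∫⁻ y in A, k y
      ≤ ∫⁻ y in A, ENNReal.ofReal c * k y := lintegral_const_mul_le _ _
    _ ≤ ∫⁻ y in A, ENNReal.ofReal (chartDensity φ y) * k y :=
        setLIntegral_mono' hA fun y hy ↦ by gcongr; exact hc y hy
    _ = ∫⁻ y in A, k y ∂coordVolume φ := by
        rw [hrestr, lintegral_withDensity_eq_lintegral_mul₀
          ((aemeasurable_chartDensity hφ).mono_measure (Measure.restrict_mono hAφ le_rfl)) hk]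
        rfl
    _ = ∫⁻ y, g y ∂coordVolume φ := by rw [← hgint, lintegral_indicator hA]
    _ = ∫⁻ y, F (φ.symm y) ∂coordVolume φ := by
        refine lintegral_congr_ae ((withDensity_absolutelyContinuous _ _).ae_le ?_)
        filter_upwards [ae_restrict_mem φ.open_target.measurableSet] with y hy
        simp [F, Φ, φ.map_target hy, φ.right_inv hy]
    _ = ∫⁻ x, F x ∂chartVolume φ := (lintegral_map' hF.aemeasurable aemeasurable_symm).symm
    _ ≤ ∫⁻ x, F x ∂riemannianVolume n M :=
        lintegral_mono' (chartVolume_le_riemannianVolume hφ) le_rfl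
    _ ≤ _ := lintegral_mono hFf

end Volume

/-! ### The Poincaré inequality in `L¹` on balls. -/

section Poincare

variable {E : Type*} [NormedAddCommGroup E] [NormedSpace ℝ E] [MeasurableSpace E] [BorelSpace E]
  [FiniteDimensional ℝ E] {μ : Measure E} [μ.IsAddHaarMeasure]

/-- The map `y ↦ (1 - s) x + s y` sends `B` into itself, and its Jacobian `s ^ d` is at least `2⁻ᵈ`.
-/
lemma setLIntegral_comp_convexCombination_le {B : Set E} (hB : MeasurableSet B)
    (hconv : Convex ℝ B) {g : E → ℝ≥0∞} (hg : Measurable g) {x : E} (hx : x ∈ B) {s : ℝ}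
    (hs : 1 / 2 ≤ s) (hs1 : s ≤ 1) :
    ∫⁻ y in B, g ((1 - s) • x + s • y) ∂μ ≤
      ENNReal.ofReal (2 ^ Module.finrank ℝ E) * ∫⁻ z in B, g z ∂μ := by
  have hs0 : 0 < s := by linarith
  have hgB : Measurable (B.indicator g) := hg.indicator hB
  calc ∫⁻ y in B, g ((1 - s) • x + s • y) ∂μ
      = ∫⁻ y in B, B.indicator g ((1 - s) • x + s • y) ∂μ := by
        refine setLIntegral_congr_fun hB fun y hy ↦ ?_
        exact (indicator_of_mem (hconv hx hy (by linarith) hs0.le (by ring)) g).symm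
    _ ≤ ∫⁻ y, B.indicator g ((1 - s) • x + s • y) ∂μ := setLIntegral_le_lintegral _ _
    _ = ∫⁻ y, B.indicator g ((1 - s) • x + y) ∂(μ.map (s • ·)) := by
        rw [lintegral_map (by fun_prop) (by fun_prop)]
    _ = ENNReal.ofReal |(s ^ Module.finrank ℝ E)⁻¹| * ∫⁻ y, B.indicator g y ∂μ := by
        rw [Measure.map_addHaar_smul μ hs0.ne', lintegral_smul_measure,
          lintegral_add_left_eq_self, smul_eq_mul]
    _ ≤ _ := by
        rw [lintegral_indicator hB]
        gcongr
        rw [abs_of_nonneg (by positivity), ← inv_pow]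
        gcongr
        rw [inv_le_comm₀ hs0 two_pos]
        linarith

/-- The Poincaré inequality in `L¹`, on a ball, for functions of class `C¹`. -/
lemma lintegral_lintegral_enorm_sub_le {f : E → ℝ} (hf : ContDiff ℝ 1 f) (p : E) (r : ℝ) :
    ∫⁻ x in Metric.ball p r, ∫⁻ y in Metric.ball p r, ‖f x - f y‖ₑ ∂μ ∂μ ≤
      ENNReal.ofReal (2 * r) * ENNReal.ofReal (2 ^ Module.finrank ℝ E) * μ (Metric.ball p r) *
        ∫⁻ z in Metric.ball p r, ‖fderiv ℝ f z‖ₑ ∂μ := by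
  set B := Metric.ball p r
  have hB : MeasurableSet B := Metric.isOpen_ball.measurableSet
  have hconv : Convex ℝ B := convex_ball p r
  set g : E → ℝ≥0∞ := fun z ↦ ‖fderiv ℝ f z‖ₑ
  have hgc : Continuous g := (hf.continuous_fderiv (by simp)).enorm
  have hg : Measurable g := hgc.measurable
  have hpt : ∀ x ∈ B, ∀ y ∈ B, ‖f x - f y‖ₑ ≤
      ENNReal.ofReal (2 * r) * ∫⁻ t in Icc (0 : ℝ) 1, g ((1 - t) • x + t • y) := by
    intro x hx y hy
    set c : ℝ → E := fun t ↦ (1 - t) • x + t • y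
    have hc : ContDiff ℝ 1 c := by fun_prop
    have hd : ∀ t, HasDerivAt c (y - x) t := by
      intro t
      have h1 : HasDerivAt (fun t : ℝ ↦ (1 - t) • x) ((-1 : ℝ) • x) t :=
        ((hasDerivAt_id t).const_sub 1).smul_const x
      have h2 : HasDerivAt (fun t : ℝ ↦ t • y) ((1 : ℝ) • y) t := (hasDerivAt_id t).smul_const y
      exact (h1.add h2).congr_deriv (by module)
    have h := enorm_sub_le_lintegral_deriv_of_contDiffOn_Icc (f := f ∘ c) (a := 0) (b := 1)
      (hf.comp hc).contDiffOn zero_le_one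
    have h0 : c 0 = x := by simp [c]
    have h1 : c 1 = y := by simp [c]
    rw [Function.comp_apply, Function.comp_apply, h0, h1] at h
    rw [← enorm_neg, neg_sub]
    refine h.trans ?_
    rw [← lintegral_const_mul _ (by fun_prop)]
    refine lintegral_mono fun t ↦ ?_
    have h2 : deriv (f ∘ c) t = fderiv ℝ f (c t) (y - x) :=
      ((hf.differentiable (by simp) (c t)).hasFDerivAt.comp_hasDerivAt t (hd t)).deriv
    rw [h2, mul_comm]
    refine (ContinuousLinearMap.le_opENorm _ _).trans ?_
    gcongr
    rw [← ofReal_norm]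
    refine ENNReal.ofReal_le_ofReal ?_
    have hx' := mem_ball_iff_norm.1 hx
    have hy' := mem_ball_iff_norm.1 hy
    calc ‖y - x‖ = ‖(y - p) - (x - p)‖ := by congr 1; abel
      _ ≤ ‖y - p‖ + ‖x - p‖ := norm_sub_le _ _
      _ ≤ 2 * r := by linarith
  have hslice : ∀ t ∈ Icc (0 : ℝ) 1, ∫⁻ x in B, ∫⁻ y in B, g ((1 - t) • x + t • y) ∂μ ∂μ ≤
      ENNReal.ofReal (2 ^ Module.finrank ℝ E) * μ B * ∫⁻ z in B, g z ∂μ := by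
    -- Substituting in `y` costs a Jacobian that degenerates as the parameter tends to `0`. For
    -- parameters below `1/2` the roles of `x` and `y` are exchanged.
    have hhalf : ∀ s : ℝ, 1 / 2 ≤ s → s ≤ 1 →
        ∫⁻ x in B, ∫⁻ y in B, g ((1 - s) • x + s • y) ∂μ ∂μ ≤
      ENNReal.ofReal (2 ^ Module.finrank ℝ E) * μ B * ∫⁻ z in B, g z ∂μ := by
      intro s hs hs1
      calc _ ≤ ∫⁻ x in B, ENNReal.ofReal (2 ^ Module.finrank ℝ E) * ∫⁻ z in B, g z ∂μ ∂μ :=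
            setLIntegral_mono' hB fun x hx ↦
              setLIntegral_comp_convexCombination_le hB hconv hg hx hs hs1
        _ = _ := by
            rw [lintegral_const, Measure.restrict_apply_univ]
            ring
    intro t ht
    rcases le_total (1 / 2) t with h | h
    · exact hhalf t h ht.2
    · refine le_trans (le_of_eq ?_) (hhalf (1 - t) (by linarith) (by linarith [ht.1]))
      rw [lintegral_lintegral_swap (by
        apply Measurable.aemeasurable
        simp only [Function.uncurry_def]
        fun_prop)]
      refine lintegral_congr fun x ↦ lintegral_congr fun y ↦ ?_
      congr 1
      module
  calc ∫⁻ x in B, ∫⁻ y in B, ‖f x - f y‖ₑ ∂μ ∂μ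
      ≤ ∫⁻ x in B, ∫⁻ y in B, ENNReal.ofReal (2 * r) *
          (∫⁻ t in Icc (0 : ℝ) 1, g ((1 - t) • x + t • y)) ∂μ ∂μ :=
        setLIntegral_mono' hB fun x hx ↦ setLIntegral_mono' hB fun y hy ↦ hpt x hx y hy
    _ = ENNReal.ofReal (2 * r) * ∫⁻ x in B, ∫⁻ y in B,
          (∫⁻ t in Icc (0 : ℝ) 1, g ((1 - t) • x + t • y)) ∂μ ∂μ := by
        rw [← lintegral_const_mul' _ _ ENNReal.ofReal_ne_top]
        refine lintegral_congr fun x ↦ ?_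
        rw [lintegral_const_mul' _ _ ENNReal.ofReal_ne_top]
    _ = ENNReal.ofReal (2 * r) * ∫⁻ t in Icc (0 : ℝ) 1, ∫⁻ x in B, ∫⁻ y in B,
          g ((1 - t) • x + t • y) ∂μ ∂μ := by
        congr 1
        have h1 : ∀ x, ∫⁻ y in B, (∫⁻ t in Icc (0 : ℝ) 1, g ((1 - t) • x + t • y)) ∂μ =
            ∫⁻ t in Icc (0 : ℝ) 1, ∫⁻ y in B, g ((1 - t) • x + t • y) ∂μ := by
          intro x
          refine lintegral_lintegral_swap (Measurable.aemeasurable ?_)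
          simp only [Function.uncurry_def]
          fun_prop
        simp_rw [h1]
        refine lintegral_lintegral_swap (Measurable.aemeasurable ?_)
        refine Measurable.lintegral_prod_right'
          (f := fun q : (E × ℝ) × E ↦ g ((1 - q.1.2) • q.1.1 + q.1.2 • q.2)) ?_
        fun_prop
    _ ≤ ENNReal.ofReal (2 * r) * ∫⁻ t in Icc (0 : ℝ) 1,
          (ENNReal.ofReal (2 ^ Module.finrank ℝ E) * μ B * ∫⁻ z in B, g z ∂μ) := by
        gcongr 1
        exact setLIntegral_mono' measurableSet_Icc hslice
    _ = _ := by
        simp only [lintegral_const, Measure.restrict_apply_univ, Real.volume_Icc, sub_zero,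
          ENNReal.ofReal_one, mul_one]
        ring

/-- `|B| f(x) - ∫_B f` is the integral of `f(x) - f(y)` over `y ∈ B`, so the double integral
estimate applies. -/
lemma exists_integral_abs_sub_le (μ : Measure E) [μ.IsAddHaarMeasure] (p : E) (r : ℝ) :
    ∃ C : ℝ, 0 ≤ C ∧ ∀ f : E → ℝ, ContDiff ℝ 1 f →
      ∫ x in Metric.ball p r, |μ.real (Metric.ball p r) * f x - ∫ y in Metric.ball p r, f y ∂μ| ∂μ ≤
        C * ∫ z in Metric.ball p r, ‖fderiv ℝ f z‖ ∂μ := by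
  set B := Metric.ball p r
  set K : ℝ≥0∞ := ENNReal.ofReal (2 * r) * ENNReal.ofReal (2 ^ Module.finrank ℝ E) * μ B
  have hK : K ≠ ⊤ := by
    refine ENNReal.mul_ne_top (ENNReal.mul_ne_top ENNReal.ofReal_ne_top ENNReal.ofReal_ne_top) ?_
    exact measure_ball_lt_top.ne
  refine ⟨K.toReal, ENNReal.toReal_nonneg, fun f hf ↦ ?_⟩
  have hint : ∀ {h : E → ℝ}, Continuous h → IntegrableOn h B μ := fun hh ↦
    (hh.continuousOn.integrableOn_compact (isCompact_closedBall p r)).mono_set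
      Metric.ball_subset_closedBall
  have hfd : Continuous fun z ↦ ‖fderiv ℝ f z‖ := (hf.continuous_fderiv (by simp)).norm
  have hB : IsFiniteMeasure (μ.restrict B) := ⟨by simpa using measure_ball_lt_top⟩
  have hpt : ∀ x, ‖μ.real B * f x - ∫ y in B, f y ∂μ‖ₑ ≤ ∫⁻ y in B, ‖f x - f y‖ₑ ∂μ := by
    intro x
    have : μ.real B * f x - ∫ y in B, f y ∂μ = ∫ y in B, (f x - f y) ∂μ := by
      rw [integral_sub (integrable_const _) (hint hf.continuous)]
      simp
    rw [this]
    exact enorm_integral_le_lintegral_enorm _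
  have h1 : ∫ x in B, |μ.real B * f x - ∫ y in B, f y ∂μ| ∂μ =
      (∫⁻ x in B, ‖μ.real B * f x - ∫ y in B, f y ∂μ‖ₑ ∂μ).toReal :=
    integral_norm_eq_lintegral_enorm ((hf.continuous.const_mul _).sub
      continuous_const).aestronglyMeasurable
  have h2 : ∫ z in B, ‖fderiv ℝ f z‖ ∂μ = (∫⁻ z in B, ‖fderiv ℝ f z‖ₑ ∂μ).toReal :=
    integral_norm_eq_lintegral_enorm (hf.continuous_fderiv (by simp)).aestronglyMeasurable
  have h3 : ∫⁻ z in B, ‖fderiv ℝ f z‖ₑ ∂μ ≠ ⊤ :=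
    (hint (h := fun z ↦ ‖fderiv ℝ f z‖) hfd).2.ne |> fun h ↦ by simpa using h
  rw [h1, h2, ← ENNReal.toReal_mul]
  refine ENNReal.toReal_mono (ENNReal.mul_ne_top hK h3) ?_
  exact (lintegral_mono hpt).trans (lintegral_lintegral_enorm_sub_le hf p r)

end Poincare

/-! ### The truncation `smoothStep` and the cutoff `plateau`. -/

section Profile

/-- A smooth nondecreasing function, equal to `-1/2` on `(-∞, -1/2]` and to `1/2` on
`[1/2, ∞)`. -/
def smoothStep (s : ℝ) : ℝ := Real.smoothTransition (s + 1 / 2) - 1 / 2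

/-- A continuous function with values in `[0, 1]`, equal to `1` on `[-1/2, 1/2]` and to `0` outside
`(-3/4, 3/4)`. -/
def plateau (s : ℝ) : ℝ := max 0 (min 1 (3 - 4 * |s|))

lemma contDiff_smoothStep : ContDiff ℝ 1 smoothStep :=
  (Real.smoothTransition.contDiff (n := 1) |>.comp (contDiff_id.add contDiff_const)).sub
    contDiff_const

lemma abs_smoothStep_le (s : ℝ) : |smoothStep s| ≤ 1 / 2 := by
  have h0 := Real.smoothTransition.nonneg (s + 1 / 2)
  have h1 := Real.smoothTransition.le_one (s + 1 / 2)
  rw [smoothStep, abs_le]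
  constructor <;> linarith

lemma smoothStep_of_le {s : ℝ} (h : s ≤ -(1 / 2)) : smoothStep s = -(1 / 2) := by
  rw [smoothStep, Real.smoothTransition.zero_of_nonpos (by linarith)]
  norm_num

lemma smoothStep_of_ge {s : ℝ} (h : 1 / 2 ≤ s) : smoothStep s = 1 / 2 := by
  rw [smoothStep, Real.smoothTransition.one_of_one_le (by linarith)]
  norm_num

lemma continuous_plateau : Continuous plateau := by unfold plateau; fun_prop

lemma plateau_nonneg (s : ℝ) : 0 ≤ plateau s := le_max_left _ _

lemma plateau_le_one (s : ℝ) : plateau s ≤ 1 := max_le zero_le_one (min_le_left _ _)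

lemma plateau_of_abs_le {s : ℝ} (h : |s| ≤ 1 / 2) : plateau s = 1 := by
  rw [plateau, min_eq_left (by linarith), max_eq_right zero_le_one]

lemma plateau_of_le_abs {s : ℝ} (h : 3 / 4 ≤ |s|) : plateau s = 0 := by
  rw [plateau, max_eq_left]
  exact (min_le_right _ _).trans (by linarith)

/-- `smoothStep` is saturated at `±1/2` wherever `plateau` drops below `1`. So a value outside the
transition region contributes to `∫ |smoothStep u|`. -/
lemma one_sub_plateau_le (s : ℝ) : 1 / 2 * (1 - plateau s) ≤ |smoothStep s| := by
  have h0 := plateau_nonneg s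
  rcases le_total |s| (1 / 2) with h | h
  · rw [plateau_of_abs_le h]
    simp
  · have : |smoothStep s| = 1 / 2 := by
      rcases le_abs.1 h with h | h
      · rw [smoothStep_of_ge h]; norm_num
      · rw [smoothStep_of_le (by linarith)]; norm_num
    rw [this]
    linarith

lemma deriv_smoothStep_eq_zero {s : ℝ} (h : 1 / 2 < |s|) : deriv smoothStep s = 0 := by
  rcases lt_abs.1 h with h | h
  · have : smoothStep =ᶠ[𝓝 s] fun _ ↦ 1 / 2 := by
      filter_upwards [lt_mem_nhds h] with x hx using smoothStep_of_ge hx.le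
    simp [this.deriv_eq]
  · have : smoothStep =ᶠ[𝓝 s] fun _ ↦ -(1 / 2) := by
      filter_upwards [gt_mem_nhds (show s < -(1 / 2) by linarith)] with x hx
      exact smoothStep_of_le hx.le
    simp [this.deriv_eq]

/-- The derivative vanishes for `|s| > 1/2`, and `plateau` equals `1` on the remaining interval. -/
lemma exists_deriv_smoothStep_le :
    ∃ L : ℝ, 0 ≤ L ∧ ∀ s, |deriv smoothStep s| ≤ L * plateau s ^ 2 := by
  obtain ⟨L, hL⟩ := (isCompact_Icc (a := (-(1 / 2) : ℝ)) (b := 1 / 2)).exists_bound_of_continuousOn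
    (contDiff_smoothStep.continuous_deriv le_rfl).continuousOn
  have hL0 : 0 ≤ L := (norm_nonneg _).trans (hL 0 (by norm_num))
  refine ⟨L, hL0, fun s ↦ ?_⟩
  rcases le_or_gt |s| (1 / 2) with h | h
  · rw [plateau_of_abs_le h]
    simpa using hL s (abs_le.1 h)
  · rw [deriv_smoothStep_eq_zero h]
    simpa using mul_nonneg hL0 (sq_nonneg _)

lemma exists_smoothStep_sub_le :
    ∃ L : ℝ, 0 ≤ L ∧ ∀ a b, |smoothStep a - smoothStep b| ≤ L * |a - b| := by
  obtain ⟨L, hL0, hL⟩ := exists_deriv_smoothStep_le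
  refine ⟨L, hL0, fun a b ↦ ?_⟩
  have h : ∀ s ∈ (univ : Set ℝ), ‖deriv smoothStep s‖ ≤ L := fun s _ ↦ (hL s).trans
    (mul_le_of_le_one_right hL0 (pow_le_one₀ (plateau_nonneg s) (plateau_le_one s)))
  simpa using convex_univ.norm_image_sub_le_of_norm_deriv_le
    (fun s _ ↦ (contDiff_smoothStep.differentiable (by simp)) s) h (mem_univ b) (mem_univ a)

end Profile

/-! ### The Modica–Mortola inequality for `C¹` functions. -/

section ModicaMortola

variable {n : ℕ}

lemma norm_le_sum_abs_apply (l : EuclideanSpace ℝ (Fin n) →L[ℝ] ℝ) :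
    ‖l‖ ≤ ∑ i, |l (EuclideanSpace.basisFun (Fin n) ℝ i)| := by
  refine l.opNorm_le_bound (Finset.sum_nonneg fun _ _ ↦ abs_nonneg _) fun x ↦ ?_
  conv_lhs => rw [← (EuclideanSpace.basisFun (Fin n) ℝ).sum_repr x]
  rw [map_sum, Finset.sum_mul]
  refine (norm_sum_le _ _).trans (Finset.sum_le_sum fun i _ ↦ ?_)
  rw [map_smul, norm_smul, mul_comm]
  gcongr
  · rfl
  · simpa using PiLp.norm_apply_le x i

lemma integrableOn_ball_of_continuous {f : EuclideanSpace ℝ (Fin n) → ℝ} (hf : Continuous f)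
    (p : EuclideanSpace ℝ (Fin n)) (r : ℝ) : IntegrableOn f (Metric.ball p r) :=
  (hf.continuousOn.integrableOn_compact (isCompact_closedBall p r)).mono_set
    Metric.ball_subset_closedBall

/-- The Modica–Mortola inequality combined with the Poincaré inequality. -/
lemma exists_integral_smoothStep_sub_le (p : EuclideanSpace ℝ (Fin n)) (r : ℝ) :
    ∃ C : ℝ, 0 ≤ C ∧ ∀ ε > 0, ∀ v : EuclideanSpace ℝ (Fin n) → ℝ, ContDiff ℝ 1 v →
      ∫ x in Metric.ball p r, |volume.real (Metric.ball p r) * smoothStep (v x) -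
          ∫ y in Metric.ball p r, smoothStep (v y)| ≤
        C * (ε * (∑ i, ∫ x in Metric.ball p r,
              (fderiv ℝ v x (EuclideanSpace.basisFun (Fin n) ℝ i)) ^ 2) +
          n / ε * ∫ x in Metric.ball p r, plateau (v x)) := by
  obtain ⟨C, hC0, hC⟩ := exists_integral_abs_sub_le
    (volume : Measure (EuclideanSpace ℝ (Fin n))) p r
  obtain ⟨L, hL0, hL⟩ := exists_deriv_smoothStep_le
  set b := EuclideanSpace.basisFun (Fin n) ℝ
  refine ⟨C * L, mul_nonneg hC0 hL0, fun ε hε v hv ↦ ?_⟩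
  have hcd : ∀ i, Continuous fun x ↦ (fderiv ℝ v x (b i)) ^ 2 := fun i ↦
    ((hv.continuous_fderiv (by simp)).clm_apply continuous_const).pow 2
  have hcp : Continuous fun x ↦ plateau (v x) := continuous_plateau.comp hv.continuous
  -- Chain rule, then Young's inequality in each coordinate direction together with `0 ≤ plateau ≤
  -- 1`. The `n` directions produce the factor `n / ε`.
  have hpt : ∀ x, ‖fderiv ℝ (smoothStep ∘ v) x‖ ≤
      L * (ε * (∑ i, (fderiv ℝ v x (b i)) ^ 2) + n / ε * plateau (v x)) := by
    intro x
    have h1 : fderiv ℝ (smoothStep ∘ v) x = deriv smoothStep (v x) • fderiv ℝ v x :=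
      ((contDiff_smoothStep.differentiable (by simp) (v x)).hasDerivAt.comp_hasFDerivAt x
        (hv.differentiable (by simp) x).hasFDerivAt).fderiv
    have hp0 := plateau_nonneg (v x)
    have hp1 := plateau_le_one (v x)
    have h2 : ∀ i, plateau (v x) ^ 2 * |fderiv ℝ v x (b i)| ≤
        ε * (fderiv ℝ v x (b i)) ^ 2 + plateau (v x) / ε := by
      intro i
      rw [← sq_abs (fderiv ℝ v x (b i))]
      set d := |fderiv ℝ v x (b i)|
      have hd : 0 ≤ d := abs_nonneg _
      set q := plateau (v x)
      have h3 : q * d ≤ ε * d ^ 2 + q ^ 2 / ε := by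
        rw [← sub_nonneg]
        have : ε * d ^ 2 + q ^ 2 / ε - q * d = ((ε * d - q) ^ 2 + ε * d * q) / ε := by
          field_simp
          ring
        rw [this]
        positivity
      have h4 : q ^ 2 ≤ q := by nlinarith
      have h5 : q ^ 2 / ε ≤ q / ε := by gcongr
      nlinarith [mul_le_mul_of_nonneg_right h4 hd]
    rw [h1, norm_smul, Real.norm_eq_abs]
    calc |deriv smoothStep (v x)| * ‖fderiv ℝ v x‖
        ≤ (L * plateau (v x) ^ 2) * ∑ i, |fderiv ℝ v x (b i)| := by
          gcongr
          · exact hL _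
          · exact norm_le_sum_abs_apply _
      _ = L * ∑ i, plateau (v x) ^ 2 * |fderiv ℝ v x (b i)| := by
          rw [mul_assoc, Finset.mul_sum]
      _ ≤ L * ∑ i, (ε * (fderiv ℝ v x (b i)) ^ 2 + plateau (v x) / ε) := by
          gcongr with i
          exact h2 i
      _ = _ := by
          rw [Finset.sum_add_distrib, ← Finset.mul_sum]
          simp only [Finset.sum_const, Finset.card_univ, Fintype.card_fin, nsmul_eq_mul]
          ring
  have hcont : Continuous fun x ↦ fderiv ℝ (smoothStep ∘ v) x :=
    (contDiff_smoothStep.comp hv).continuous_fderiv (by simp)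
  have hcs : Continuous fun x ↦ ∑ i, (fderiv ℝ v x (b i)) ^ 2 :=
    continuous_finsetSum _ fun i _ ↦ hcd i
  refine (hC _ (contDiff_smoothStep.comp hv)).trans ?_
  rw [mul_assoc]
  gcongr
  calc ∫ x in Metric.ball p r, ‖fderiv ℝ (smoothStep ∘ v) x‖
      ≤ ∫ x in Metric.ball p r,
          L * (ε * (∑ i, (fderiv ℝ v x (b i)) ^ 2) + n / ε * plateau (v x)) :=
        integral_mono (integrableOn_ball_of_continuous hcont.norm p r)
          (integrableOn_ball_of_continuous (by fun_prop) p r) hpt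
    _ = _ := by
      rw [integral_const_mul, integral_add (integrableOn_ball_of_continuous (by fun_prop) p r)
        (integrableOn_ball_of_continuous (by fun_prop) p r), integral_const_mul,
        integral_const_mul, integral_finsetSum _
          fun i _ ↦ integrableOn_ball_of_continuous (hcd i) p r]

end ModicaMortola

/-! ### Approximation of Sobolev functions by `C¹` functions. -/

section Mollification

open scoped Convolution

variable {n : ℕ}

local notation "lsm" => ContinuousLinearMap.lsmul ℝ ℝ

/-- `(η * G)² ≤ η * G²` for a probability density `η`. -/
lemma sq_integral_mul_le {E : Type*} [MeasurableSpace E] {μ : Measure E} {η G : E → ℝ}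
    (hη : ∀ t, 0 ≤ η t) (hη1 : ∫ t, η t ∂μ = 1)
    (hG : Integrable (fun t ↦ η t * G t) μ) (hG2 : Integrable (fun t ↦ η t * G t ^ 2) μ) :
    (∫ t, η t * G t ∂μ) ^ 2 ≤ ∫ t, η t * G t ^ 2 ∂μ := by
  set D := ∫ t, η t * G t ∂μ
  have hηi : Integrable η μ := by
    by_contra h
    rw [integral_undef h] at hη1
    exact zero_ne_one hη1
  have h0 : 0 ≤ ∫ t, η t * (G t - D) ^ 2 ∂μ :=
    integral_nonneg fun t ↦ mul_nonneg (hη t) (sq_nonneg _)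
  have h1 : ∫ t, η t * (G t - D) ^ 2 ∂μ = ∫ t, η t * G t ^ 2 ∂μ - D ^ 2 := by
    calc ∫ t, η t * (G t - D) ^ 2 ∂μ
        = ∫ t, (η t * G t ^ 2 - 2 * D * (η t * G t) + D ^ 2 * η t) ∂μ := by
          congr 1 with t
          ring
      _ = _ := by
          rw [integral_add (f := fun t ↦ η t * G t ^ 2 - 2 * D * (η t * G t))
            (hG2.sub (hG.const_mul _)) (hηi.const_mul _), integral_sub hG2 (hG.const_mul _),
            integral_const_mul, integral_const_mul, hη1]
          ring
  linarith

/-- The derivative of a mollification is the mollification of the weak derivative. -/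
lemma fderiv_convolution_eq {B' : Set (EuclideanSpace ℝ (Fin n))}
    {u g η : EuclideanSpace ℝ (Fin n) → ℝ} {x e : EuclideanSpace ℝ (Fin n)}
    (hwi : Integrable (B'.indicator u)) (hηs : ∀ m : ℕ∞, ContDiff ℝ m η)
    (hηc : HasCompactSupport η) (hsupp : tsupport (fun t ↦ η (x - t)) ⊆ B')
    (hw : ∀ ζ : EuclideanSpace ℝ (Fin n) → ℝ, ContDiff ℝ ∞ ζ → HasCompactSupport ζ →
      tsupport ζ ⊆ B' → ∫ y, u y * fderiv ℝ ζ y e = -∫ y, g y * ζ y) :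
    fderiv ℝ (η ⋆[lsm] (B'.indicator u)) x e = ∫ t, η (x - t) * B'.indicator g t := by
  -- The reflected kernel serves as the test function. The sign from differentiating `x - t` cancels
  -- the sign in the definition of the weak derivative.
  set ζ : EuclideanSpace ℝ (Fin n) → ℝ := fun t ↦ η (x - t)
  have hζs : ContDiff ℝ ∞ ζ := (hηs ⊤).comp (contDiff_const.sub contDiff_id)
  have hζc : HasCompactSupport ζ := hηc.comp_homeomorph (Homeomorph.subLeft x)
  have hζ0 : ∀ t ∉ B', ζ t = 0 := fun t ht ↦ image_eq_zero_of_notMem_tsupport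
    fun h ↦ ht (hsupp h)
  have hζd : ∀ t, fderiv ℝ ζ t e = -fderiv ℝ η (x - t) e := by
    intro t
    have h1 : HasFDerivAt (fun t : EuclideanSpace ℝ (Fin n) ↦ x - t)
      (-ContinuousLinearMap.id ℝ _) t := (hasFDerivAt_id t).const_sub x
    have h2 := ((hηs 1).differentiable (by simp) (x - t)).hasFDerivAt.comp t h1
    have h3 : fderiv ℝ ζ t = _ := h2.fderiv
    rw [h3]
    simp
  have hζd0 : ∀ t ∉ B', fderiv ℝ ζ t e = 0 := by
    intro t ht
    rw [fderiv_of_notMem_tsupport ℝ (fun h ↦ ht (hsupp h))]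
    rfl
  have h1 := hηc.hasFDerivAt_convolution_right (lsm).flip hwi.locallyIntegrable (hηs 1) x
  rw [convolution_flip] at h1
  rw [h1.fderiv, convolution_precompR_apply _ hwi.locallyIntegrable (hηc.fderiv ℝ)
    ((hηs 1).continuous_fderiv (by simp)), convolution_def]
  calc ∫ t, ((lsm).flip (B'.indicator u t)) (fderiv ℝ η (x - t) e)
      = ∫ t, -(u t * fderiv ℝ ζ t e) := by
        congr 1 with t
        by_cases ht : t ∈ B'
        · rw [indicator_of_mem ht, hζd t, ContinuousLinearMap.flip_apply,
            ContinuousLinearMap.lsmul_apply, smul_eq_mul]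
          ring
        · rw [indicator_of_notMem ht, hζd0 t ht]
          simp
    _ = ∫ t, g t * ζ t := by rw [integral_neg, hw ζ hζs hζc hsupp, neg_neg]
    _ = _ := by
        congr 1 with t
        by_cases ht : t ∈ B'
        · rw [indicator_of_mem ht, mul_comm]
        · rw [hζ0 t ht, indicator_of_notMem ht, mul_zero, mul_zero]

/-- The functions `u` on `ball p (2 r)` with weak partial derivatives in `L²` are approximated on
`ball p r` by functions of class `C¹`, without increase of the Dirichlet integrals. -/
lemma exists_smooth_approximation {p : EuclideanSpace ℝ (Fin n)} {r : ℝ} (hr : 0 < r)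
    {u : EuclideanSpace ℝ (Fin n) → ℝ} {G : Fin n → EuclideanSpace ℝ (Fin n) → ℝ}
    (hu : MemLp u 2 (volume.restrict (Metric.ball p (2 * r))))
    (hG : ∀ i, MemLp (G i) 2 (volume.restrict (Metric.ball p (2 * r))))
    (hw : ∀ η : EuclideanSpace ℝ (Fin n) → ℝ, ContDiff ℝ ∞ η → HasCompactSupport η →
      tsupport η ⊆ Metric.ball p (2 * r) → ∀ i,
        ∫ y, u y * fderiv ℝ η y (EuclideanSpace.basisFun (Fin n) ℝ i) = -∫ y, G i y * η y) :
    ∃ v : ℕ → EuclideanSpace ℝ (Fin n) → ℝ, (∀ k, ContDiff ℝ 1 (v k)) ∧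
      (∀ᵐ x ∂volume.restrict (Metric.ball p r), Tendsto (fun k ↦ v k x) atTop (𝓝 (u x))) ∧
      ∀ k i, ∫ x in Metric.ball p r,
          (fderiv ℝ (v k) x (EuclideanSpace.basisFun (Fin n) ℝ i)) ^ 2 ≤
        ∫ x in Metric.ball p (2 * r), G i x ^ 2 := by
  set b := EuclideanSpace.basisFun (Fin n) ℝ
  set B := Metric.ball p r
  set B' := Metric.ball p (2 * r)
  have hB : MeasurableSet B := Metric.isOpen_ball.measurableSet
  have hB' : MeasurableSet B' := Metric.isOpen_ball.measurableSet
  have hfin : IsFiniteMeasure (volume.restrict B') := ⟨by simpa using measure_ball_lt_top⟩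
  set w := B'.indicator u
  have hwi : Integrable w := (integrable_indicator_iff hB').2 (hu.integrable one_le_two)
  have hGi : ∀ i, Integrable (B'.indicator (G i)) := fun i ↦
    (integrable_indicator_iff hB').2 ((hG i).integrable one_le_two)
  have hG2 : ∀ i, Integrable (B'.indicator fun t ↦ G i t ^ 2) := fun i ↦
    (integrable_indicator_iff hB').2 (hG i).integrable_sq
  -- The outer radius stays below `r`, so kernels centred in `ball p r` are supported in `ball p (2
  -- * r)`. The ratio of the radii is fixed at `2`, as the almost everywhere convergence of the
  -- convolutions requires.
  set φ : ℕ → ContDiffBump (0 : EuclideanSpace ℝ (Fin n)) := fun k ↦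
    { rIn := r / (k + 1) / 4
      rOut := r / (k + 1) / 2
      rIn_pos := by positivity
      rIn_lt_rOut := by
        have : 0 < r / (k + 1) := by positivity
        linarith }
  have hrOut : ∀ k, (φ k).rOut < r := by
    intro k
    have h1 : r / (k + 1) ≤ r := div_le_self hr.le (by simp)
    change r / (k + 1) / 2 < r
    linarith
  have htend : Tendsto (fun k ↦ (φ k).rOut) atTop (𝓝 0) := by
    have h1 : Tendsto (fun k : ℕ ↦ r / 2 * (1 / ((k : ℝ) + 1))) atTop (𝓝 (r / 2 * 0)) :=
      tendsto_one_div_add_atTop_nhds_zero_nat.const_mul _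
    rw [mul_zero] at h1
    refine h1.congr fun k ↦ ?_
    change _ = r / (k + 1) / 2
    ring
  set η : ℕ → EuclideanSpace ℝ (Fin n) → ℝ := fun k ↦ (φ k).normed volume
  have hηs : ∀ k (m : ℕ∞), ContDiff ℝ m (η k) := fun k m ↦ (φ k).contDiff_normed
  have hηc : ∀ k, HasCompactSupport (η k) := fun k ↦ (φ k).hasCompactSupport_normed
  have hη0 : ∀ k t, 0 ≤ η k t := fun k t ↦ (φ k).nonneg_normed t
  have hηts : ∀ k, tsupport (η k) = Metric.closedBall 0 (φ k).rOut := fun k ↦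
    (φ k).tsupport_normed_eq
  have hη1 : ∀ k, ∫ t, η k t = 1 := fun k ↦ (φ k).integral_normed
  refine ⟨fun k ↦ η k ⋆[lsm] w, fun k ↦ ?_, ?_, fun k i ↦ ?_⟩
  · exact (hηc k).contDiff_convolution_left _ (hηs k 1) hwi.locallyIntegrable
  · have h1 := ContDiffBump.ae_convolution_tendsto_right_of_locallyIntegrable (K := 2) htend
      (.of_forall fun k ↦ by
        change r / (k + 1) / 2 ≤ 2 * (r / (k + 1) / 4)
        linarith) hwi.locallyIntegrable
    filter_upwards [ae_restrict_of_ae h1, ae_restrict_mem hB] with x hx hxB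
    have h2 : w x = u x :=
      indicator_of_mem (Metric.ball_subset_ball (by linarith) hxB) u
    rwa [h2] at hx
  -- The squared derivative of the mollification is at most the mollification of the squared weak
  -- derivative, by Jensen. Integrating the latter over the whole space loses nothing, since the
  -- kernel has mass `1`.
  · have hpt : ∀ x ∈ B, (fderiv ℝ (η k ⋆[lsm] w) x (b i)) ^ 2 ≤
        (η k ⋆[lsm] (B'.indicator fun t ↦ G i t ^ 2)) x := by
      intro x hx
      set ζ : EuclideanSpace ℝ (Fin n) → ℝ := fun t ↦ η k (x - t)
      have hζs : ContDiff ℝ 1 ζ := (hηs k 1).comp (contDiff_const.sub contDiff_id)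
      have hζc : HasCompactSupport ζ := (hηc k).comp_homeomorph (Homeomorph.subLeft x)
      have hζsupp : tsupport ζ ⊆ B' := by
        have h1 : tsupport ζ ⊆ Metric.closedBall x (φ k).rOut := by
          refine closure_minimal (fun t ht ↦ ?_) Metric.isClosed_closedBall
          have : x - t ∈ tsupport (η k) := subset_tsupport _ ht
          rw [hηts, mem_closedBall_zero_iff] at this
          rwa [Metric.mem_closedBall, dist_comm, dist_eq_norm]
        refine h1.trans (Metric.closedBall_subset_ball' ?_)
        have := Metric.mem_ball.1 hx
        linarith [hrOut k]
      have hD : fderiv ℝ (η k ⋆[lsm] w) x (b i) = ∫ t, ζ t * B'.indicator (G i) t :=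
        fderiv_convolution_eq hwi (hηs k) (hηc k) hζsupp fun ζ h1 h2 h3 ↦ hw ζ h1 h2 h3 i
      have hbdd : ∃ K, ∀ t, ‖ζ t‖ ≤ K := hζs.continuous.bounded_above_of_compact_support hζc
      obtain ⟨K, hK⟩ := hbdd
      have hmeas : AEStronglyMeasurable ζ volume := hζs.continuous.aestronglyMeasurable
      have hind : ∀ t, B'.indicator (G i) t ^ 2 = B'.indicator (fun t ↦ G i t ^ 2) t := by
        intro t
        by_cases ht : t ∈ B' <;> simp [ht]
      have hζ1 : ∫ t, ζ t = 1 := by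
        rw [← hη1 k]
        exact integral_sub_left_eq_self (η k) volume x
      rw [hD, convolution_eq_swap]
      refine (sq_integral_mul_le (fun t ↦ hη0 k _) hζ1 ?_ ?_).trans_eq ?_
      · exact (hGi i).bdd_mul hmeas (.of_forall hK)
      · simp_rw [hind]
        exact (hG2 i).bdd_mul hmeas (.of_forall hK)
      · simp_rw [hind]
        rfl
    have hηi : Integrable (η k) := (hηs k 1).continuous.integrable_of_hasCompactSupport (hηc k)
    have hci : Integrable (η k ⋆[lsm] (B'.indicator fun t ↦ G i t ^ 2)) :=
      hηi.integrable_convolution (lsm) (hG2 i)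
    have hvs : ContDiff ℝ 1 (η k ⋆[lsm] w) :=
      (hηc k).contDiff_convolution_left _ (hηs k 1) hwi.locallyIntegrable
    calc ∫ x in B, (fderiv ℝ (η k ⋆[lsm] w) x (b i)) ^ 2
        ≤ ∫ x in B, (η k ⋆[lsm] (B'.indicator fun t ↦ G i t ^ 2)) x :=
          setIntegral_mono_on (integrableOn_ball_of_continuous
            (((hvs.continuous_fderiv (by simp)).clm_apply continuous_const).pow 2) p r)
            hci.integrableOn hB hpt
      _ ≤ ∫ x, (η k ⋆[lsm] (B'.indicator fun t ↦ G i t ^ 2)) x := by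
          refine setIntegral_le_integral hci (.of_forall fun x ↦ ?_)
          refine integral_nonneg fun t ↦ mul_nonneg (hη0 k t) ?_
          exact indicator_nonneg (fun _ _ ↦ sq_nonneg _) _
      _ = ∫ x in B', G i x ^ 2 := by
          rw [integral_convolution (lsm) hηi (hG2 i), hη1, integral_indicator hB']
          simp

end Mollification

/-! ### The energy of a balanced function on a Euclidean ball. -/

section LocalBound

variable {n : ℕ}

/-- A function on a ball which is balanced between the two wells has energy bounded below. -/
lemma exists_le_energy_of_integral_eq_zero (p : EuclideanSpace ℝ (Fin n)) {r : ℝ} (hr : 0 < r) :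
    ∃ c : ℝ, 0 < c ∧ ∀ (ε : ℝ) (u : EuclideanSpace ℝ (Fin n) → ℝ)
      (G : Fin n → EuclideanSpace ℝ (Fin n) → ℝ), 0 < ε → ε ≤ 1 →
      MemLp u 2 (volume.restrict (Metric.ball p (2 * r))) →
      (∀ i, MemLp (G i) 2 (volume.restrict (Metric.ball p (2 * r)))) →
      (∀ η : EuclideanSpace ℝ (Fin n) → ℝ, ContDiff ℝ ∞ η → HasCompactSupport η →
        tsupport η ⊆ Metric.ball p (2 * r) → ∀ i,
          ∫ y, u y * fderiv ℝ η y (EuclideanSpace.basisFun (Fin n) ℝ i) = -∫ y, G i y * η y) →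
      ∫ x in Metric.ball p r, smoothStep (u x) = 0 →
      c ≤ ε * (∑ i, ∫ x in Metric.ball p (2 * r), G i x ^ 2) +
        1 / ε * ∫ x in Metric.ball p r, plateau (u x) := by
  set B := Metric.ball p r
  set B' := Metric.ball p (2 * r)
  set V := volume.real B
  have hV : 0 < V := ENNReal.toReal_pos (Metric.measure_ball_pos volume p hr).ne'
    measure_ball_lt_top.ne
  obtain ⟨C, hC0, hC⟩ := exists_integral_smoothStep_sub_le p r
  -- Let `X` be the right-hand side of the claim and `β = ∫_B plateau u`. The argument gives `V (V -
  -- β) / 2 ≤ C (n + 1) X`, and `β ≤ X` since `ε ≤ 1`; hence `V² / 2 ≤ (C (n + 1) + V / 2) X`.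
  refine ⟨V ^ 2 / 2 / (C * (n + 1) + V / 2), by positivity, fun ε u G hε hε1 hu hG hw h0 ↦ ?_⟩
  have hfin : IsFiniteMeasure (volume.restrict B) := ⟨by simpa using measure_ball_lt_top⟩
  obtain ⟨v, hvs, hvu, hvG⟩ := exists_smooth_approximation hr hu hG hw
  have hum : AEStronglyMeasurable u (volume.restrict B) := hu.aestronglyMeasurable.mono_measure
    (Measure.restrict_mono (Metric.ball_subset_ball (by linarith)) le_rfl)
  have hlim : ∀ (F : ℝ → ℝ), Continuous F → (∀ s, |F s| ≤ 1) →
      Tendsto (fun k ↦ ∫ x in B, F (v k x)) atTop (𝓝 (∫ x in B, F (u x))) := by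
    intro F hF hF1
    refine tendsto_integral_of_dominated_convergence (fun _ ↦ 1)
      (fun k ↦ (hF.comp (hvs k).continuous).aestronglyMeasurable) (integrable_const _)
      (fun k ↦ .of_forall fun x ↦ hF1 _) ?_
    filter_upwards [hvu] with x hx using (hF.tendsto _).comp hx
  have hstep1 : ∀ s, |smoothStep s| ≤ 1 := fun s ↦ (abs_smoothStep_le s).trans (by norm_num)
  have hs := hlim smoothStep contDiff_smoothStep.continuous hstep1
  have hsa := hlim (fun s ↦ |smoothStep s|) contDiff_smoothStep.continuous.abs
    (fun s ↦ by simpa using hstep1 s)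
  have hp := hlim plateau continuous_plateau
    (fun s ↦ by rw [abs_of_nonneg (plateau_nonneg s)]; exact plateau_le_one s)
  rw [h0] at hs
  set g := ∑ i, ∫ x in B', G i x ^ 2
  set β := ∫ x in B, plateau (u x)
  -- The approximations need not be balanced, so their mean appears as an error term. It tends to
  -- `0` because `u` is balanced.
  have hk : ∀ k, V * ∫ x in B, |smoothStep (v k x)| ≤
      C * (ε * g + n / ε * ∫ x in B, plateau (v k x)) + V * |∫ x in B, smoothStep (v k x)| := by
    intro k
    have hsc : Continuous fun x ↦ smoothStep (v k x) :=
      contDiff_smoothStep.continuous.comp (hvs k).continuous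
    have h1 := hC ε hε (v k) (hvs k)
    have h2 : C * (ε * (∑ i, ∫ x in B,
        (fderiv ℝ (v k) x (EuclideanSpace.basisFun (Fin n) ℝ i)) ^ 2) +
          n / ε * ∫ x in B, plateau (v k x)) ≤
        C * (ε * g + n / ε * ∫ x in B, plateau (v k x)) := by
      gcongr
      exact Finset.sum_le_sum fun i _ ↦ hvG k i
    set m := ∫ x in B, smoothStep (v k x)
    have h3 : V * (∫ x in B, |smoothStep (v k x)|) - V * |m| ≤
        ∫ x in B, |V * smoothStep (v k x) - m| := by
      calc V * (∫ x in B, |smoothStep (v k x)|) - V * |m|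
          = ∫ x in B, (V * |smoothStep (v k x)| - |m|) := by
            rw [integral_sub ((integrableOn_ball_of_continuous hsc.abs p r).const_mul V)
              (integrable_const _), integral_const_mul, integral_const,
              measureReal_restrict_apply_univ, smul_eq_mul]
        _ ≤ _ := by
            refine integral_mono (integrableOn_ball_of_continuous (by fun_prop) p r)
              (integrableOn_ball_of_continuous (by fun_prop) p r) fun x ↦ ?_
            dsimp only
            have := abs_sub_abs_le_abs_sub (V * smoothStep (v k x)) m
            rwa [abs_mul, abs_of_pos hV] at this
    linarith
  have hmain : V * ∫ x in B, |smoothStep (u x)| ≤ C * (ε * g + n / ε * β) := by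
    have := le_of_tendsto_of_tendsto' (hsa.const_mul V)
      (((((hp.const_mul (n / ε)).const_add (ε * g)).const_mul C)).add
        ((hs.abs).const_mul V)) hk
    simpa using this
  have hβi : Integrable (fun x ↦ plateau (u x)) (volume.restrict B) :=
    Integrable.of_bound (continuous_plateau.comp_aestronglyMeasurable hum) 1
      (.of_forall fun x ↦ by
        rw [Real.norm_eq_abs, abs_of_nonneg (plateau_nonneg _)]; exact plateau_le_one _)
  have hsi : Integrable (fun x ↦ |smoothStep (u x)|) (volume.restrict B) :=
    Integrable.of_bound (contDiff_smoothStep.continuous.abs.comp_aestronglyMeasurable hum) 1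
      (.of_forall fun x ↦ by simpa using hstep1 _)
  have hlow : 1 / 2 * (V - β) ≤ ∫ x in B, |smoothStep (u x)| := by
    calc 1 / 2 * (V - β) = ∫ x in B, 1 / 2 * (1 - plateau (u x)) := by
          rw [integral_const_mul, integral_sub (integrable_const _) hβi]
          simp [V, β]
      _ ≤ _ := integral_mono (((integrable_const _).sub hβi).const_mul _) hsi
        fun x ↦ one_sub_plateau_le _
  have hg0 : 0 ≤ g := Finset.sum_nonneg fun i _ ↦ integral_nonneg fun x ↦ sq_nonneg _
  have hβ0 : 0 ≤ β := integral_nonneg fun x ↦ plateau_nonneg _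
  have hβX : β ≤ 1 / ε * β := le_mul_of_one_le_left hβ0 ((one_le_div hε).2 hε1)
  have hεg : 0 ≤ ε * g := mul_nonneg hε.le hg0
  rw [div_le_iff₀ (by positivity)]
  set X := ε * g + 1 / ε * β
  have h1 : C * (ε * g + n / ε * β) ≤ C * ((n + 1) * X) := by
    gcongr
    have : (n : ℝ) / ε * β = n * (1 / ε * β) := by ring
    rw [this]
    have h2 : 0 ≤ (n : ℝ) * (ε * g) := by positivity
    have h3 : 0 ≤ 1 / ε * β := hβ0.trans hβX
    simp only [X]
    linarith
  have h2 : V * (1 / 2 * (V - β)) ≤ C * ((n + 1) * X) :=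
    (mul_le_mul_of_nonneg_left hlow hV.le).trans (hmain.trans h1)
  have h3 : V * β ≤ V * X := by
    gcongr
    simp only [X]
    linarith
  linarith

end LocalBound

/-! ### Lower bound for the potential between the wells. -/

section DoubleWell

variable {W : ℝ → ℝ}

/-- A zero in the open interval is a minimum of `W`, hence critical, hence equal to `γ`. As `γ` is
also a local maximum, `W` would vanish near it, giving infinitely many critical points. -/
lemma IsDoubleWell.pos_of_mem_Ioo (hW : IsDoubleWell W) {s : ℝ} (hs : s ∈ Ioo (-1 : ℝ) 1) :
    0 < W s := by
  obtain ⟨γ, -, hmax, hcrit⟩ := hW.critical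
  refine (hW.nonneg s).lt_of_ne' fun h0 ↦ ?_
  have hmin : IsLocalMin W s := .of_forall fun x ↦ by rw [h0]; exact hW.nonneg x
  have hsγ : s = γ := by
    have : s ∈ {s | deriv W s = 0} := hmin.deriv_eq_zero
    rw [hcrit] at this
    rcases this with h | h | h
    · exact absurd h hs.1.ne'
    · exact h
    · exact absurd h hs.2.ne
  subst hsγ
  have hzero : W =ᶠ[𝓝 s] fun _ ↦ 0 := by
    filter_upwards [hmax] with x hx using le_antisymm (hx.trans h0.le) (hW.nonneg x)
  have hnhds : {x | deriv W x = 0} ∈ 𝓝 s := by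
    filter_upwards [hzero.deriv] with x hx
    simpa using hx
  rw [hcrit] at hnhds
  exact infinite_of_mem_nhds s hnhds (Set.toFinite _)

/-- The constant is the minimum of `W` on `[-3/4, 3/4]`; outside this interval `plateau` is `0`. The
lower bound uses no other information on `W`. -/
lemma IsDoubleWell.exists_mul_plateau_le (hW : IsDoubleWell W) :
    ∃ a > 0, ∀ s, a * plateau s ≤ W s := by
  obtain ⟨s₀, hs₀, hmin⟩ := (isCompact_Icc (a := (-(3 / 4) : ℝ)) (b := 3 / 4)).exists_isMinOn
    ⟨0, by norm_num⟩ hW.contDiff.continuous.continuousOn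
  refine ⟨W s₀, hW.pos_of_mem_Ioo ⟨by linarith [hs₀.1], by linarith [hs₀.2]⟩, fun s ↦ ?_⟩
  rcases le_total |s| (3 / 4) with h | h
  · exact (mul_le_of_le_one_right (hW.nonneg _) (plateau_le_one s)).trans (hmin (abs_le.1 h))
  · rw [plateau_of_le_abs h, mul_zero]
    exact hW.nonneg s

end DoubleWell

/-! ### Elements of `H¹(M)` read in a controlled coordinate ball. -/

section LowerBound

lemma memLp_two_of_lintegral_ofReal_sq_lt_top {X : Type*} [MeasurableSpace X] {μ : Measure X}
    {f : X → ℝ} (hf : AEStronglyMeasurable f μ) (h : ∫⁻ x, ENNReal.ofReal (f x ^ 2) ∂μ < ⊤) :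
    MemLp f 2 μ := by
  rw [memLp_two_iff_integrable_sq hf]
  refine ⟨hf.pow 2, ?_⟩
  rw [hasFiniteIntegral_iff_ofReal (.of_forall fun _ ↦ sq_nonneg _)]
  exact h

variable {n : ℕ} {M : Type*} [TopologicalSpace M] [ChartedSpace (EuclideanSpace ℝ (Fin n)) M]
  [IsManifold (𝓡 n) ∞ M]
  [RiemannianBundle (fun x : M ↦ TangentSpace (𝓡 n) x)]
  [IsContMDiffRiemannianBundle (𝓡 n) ∞ (EuclideanSpace ℝ (Fin n))
      (fun x : M ↦ TangentSpace (𝓡 n) x)]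
  {φ : OpenPartialHomeomorph M (EuclideanSpace ℝ (Fin n))}

/-- On the set `B` of coordinates of the chart `φ` the metric and the volume density are
controlled by the constants `Q` and `c`. -/
structure IsControlledOn (φ : OpenPartialHomeomorph M (EuclideanSpace ℝ (Fin n)))
    (B : Set (EuclideanSpace ℝ (Fin n))) (c Q : ℝ) : Prop where
  mem_atlas : φ ∈ atlas (EuclideanSpace ℝ (Fin n)) M
  subset_target : B ⊆ φ.target
  pos : 0 < c
  one_le : 1 ≤ Q
  le_density : ∀ y ∈ B, c ≤ chartDensity φ y
  coeff_le : ∀ y ∈ B, ∀ i, metricCoeff φ y (EuclideanSpace.basisFun (Fin n) ℝ i)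
    (EuclideanSpace.basisFun (Fin n) ℝ i) ≤ Q

variable (n M) in
lemma exists_isControlledOn_ball [Nonempty M] :
    ∃ (φ : OpenPartialHomeomorph M (EuclideanSpace ℝ (Fin n))) (p : EuclideanSpace ℝ (Fin n))
      (r c Q : ℝ), 0 < r ∧ IsControlledOn φ (Metric.ball p (2 * r)) c Q := by
  obtain ⟨x⟩ := ‹Nonempty M›
  set φ := chartAt (EuclideanSpace ℝ (Fin n)) x
  have hφ : φ ∈ atlas (EuclideanSpace ℝ (Fin n)) M := chart_mem_atlas _ x
  obtain ⟨R, hR, hball⟩ := Metric.nhds_basis_closedBall.mem_iff.1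
    (φ.open_target.mem_nhds (φ.map_source (mem_chart_source _ x)))
  have hK := isCompact_closedBall (φ x) R
  obtain ⟨y₀, hy₀, hmin⟩ := hK.exists_isMinOn ⟨_, Metric.mem_closedBall_self hR.le⟩
    ((continuousOn_chartDensity hφ).mono hball)
  choose Q hQ using fun i ↦ hK.exists_bound_of_continuousOn
    ((continuousOn_metricCoeff hφ (EuclideanSpace.basisFun (Fin n) ℝ i)
      (EuclideanSpace.basisFun (Fin n) ℝ i)).mono hball)
  have hsub : Metric.ball (φ x) (2 * (R / 2)) ⊆ Metric.closedBall (φ x) R := by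
    rw [mul_div_cancel₀ R two_ne_zero]
    exact Metric.ball_subset_closedBall
  refine ⟨φ, φ x, R / 2, chartDensity φ y₀, 1 + ∑ i, |Q i|, by linarith, hφ,
    hsub.trans hball, chartDensity_pos hφ (hball hy₀),
    le_add_of_nonneg_right (Finset.sum_nonneg fun _ _ ↦ abs_nonneg _),
    fun y hy ↦ hmin (hsub hy), fun y hy i ↦ ?_⟩
  calc _ ≤ Q i := (le_abs_self _).trans (hQ i y (hsub hy))
    _ ≤ |Q i| := le_abs_self _
    _ ≤ ∑ i, |Q i| := Finset.single_le_sum (f := fun i ↦ |Q i|)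
        (fun _ _ ↦ abs_nonneg _) (Finset.mem_univ i)
    _ ≤ _ := by linarith

variable [MeasurableSpace M] [BorelSpace M]

/-- The weak partial derivatives in the chart `φ` of an element of `H¹(M)`. -/
def H1.partialDeriv (h : H1 n M) (φ : OpenPartialHomeomorph M (EuclideanSpace ℝ (Fin n)))
    (i : Fin n) (y : EuclideanSpace ℝ (Fin n)) : ℝ :=
  inner ℝ (h.grad (φ.symm y)) (coordVector φ (EuclideanSpace.basisFun (Fin n) ℝ i) y)

namespace IsControlledOn

variable {B : Set (EuclideanSpace ℝ (Fin n))} {c Q : ℝ}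

lemma lt_top_of_lintegral_lt_top (hφ : IsControlledOn φ B c Q) (hB : MeasurableSet B)
    {k : EuclideanSpace ℝ (Fin n) → ℝ≥0∞} (hk : AEMeasurable k (volume.restrict B))
    {f : M → ℝ≥0∞} (hkf : ∀ y ∈ B, k y ≤ f (φ.symm y))
    (hf : ∫⁻ x, f x ∂riemannianVolume n M < ⊤) : ∫⁻ y in B, k y < ⊤ := by
  have h := (lintegral_coord_le hφ.mem_atlas hB hφ.subset_target hk hkf hφ.le_density).trans_lt hf
  exact ENNReal.lt_top_of_mul_ne_top_right h.ne (by simpa using hφ.pos)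

lemma aestronglyMeasurable_toFun (hφ : IsControlledOn φ B c Q) (h : H1 n M) :
    AEStronglyMeasurable (fun y ↦ h.toFun (φ.symm y)) (volume.restrict B) :=
  (aestronglyMeasurable_comp_symm hφ.mem_atlas h.memLp.aestronglyMeasurable).mono_measure
    (Measure.restrict_mono hφ.subset_target le_rfl)

lemma memLp_toFun (hφ : IsControlledOn φ B c Q) (hB : MeasurableSet B) (h : H1 n M) :
    MemLp (fun y ↦ h.toFun (φ.symm y)) 2 (volume.restrict B) := by
  have hm := hφ.aestronglyMeasurable_toFun h
  refine memLp_two_of_lintegral_ofReal_sq_lt_top hm ?_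
  refine hφ.lt_top_of_lintegral_lt_top hB (hm.pow 2).aemeasurable.ennreal_ofReal
    (f := fun x ↦ ENNReal.ofReal (h.toFun x ^ 2)) (fun _ _ ↦ le_rfl) ?_
  have := h.memLp.integrable_sq.2
  rwa [hasFiniteIntegral_iff_ofReal (.of_forall fun _ ↦ sq_nonneg _)] at this

lemma aemeasurable_partialDeriv (hφ : IsControlledOn φ B c Q) (h : H1 n M) (i : Fin n) :
    AEMeasurable (h.partialDeriv φ i) (volume.restrict B) :=
  (h.aemeasurable_grad φ hφ.mem_atlas _).mono_measure
    (Measure.restrict_mono hφ.subset_target le_rfl)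

lemma sq_partialDeriv_le (hφ : IsControlledOn φ B c Q) (h : H1 n M) (i : Fin n)
    {y : EuclideanSpace ℝ (Fin n)} (hy : y ∈ B) :
    h.partialDeriv φ i y ^ 2 ≤ Q * ‖h.grad (φ.symm y)‖ ^ 2 := by
  have h1 := abs_real_inner_le_norm (h.grad (φ.symm y))
    (coordVector φ (EuclideanSpace.basisFun (Fin n) ℝ i) y)
  have h2 : ‖coordVector φ (EuclideanSpace.basisFun (Fin n) ℝ i) y‖ ^ 2 ≤ Q := by
    rw [← real_inner_self_eq_norm_sq]
    exact hφ.coeff_le y hy i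
  calc h.partialDeriv φ i y ^ 2
      ≤ (‖h.grad (φ.symm y)‖ * ‖coordVector φ (EuclideanSpace.basisFun (Fin n) ℝ i) y‖) ^ 2 :=
        sq_le_sq' (abs_le.1 h1).1 (abs_le.1 h1).2
    _ = ‖coordVector φ (EuclideanSpace.basisFun (Fin n) ℝ i) y‖ ^ 2 *
          ‖h.grad (φ.symm y)‖ ^ 2 := by ring
    _ ≤ _ := by gcongr

lemma memLp_partialDeriv (hφ : IsControlledOn φ B c Q) (hB : MeasurableSet B) (h : H1 n M)
    (i : Fin n) : MemLp (h.partialDeriv φ i) 2 (volume.restrict B) := by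
  have hm := hφ.aemeasurable_partialDeriv h i
  refine memLp_two_of_lintegral_ofReal_sq_lt_top hm.aestronglyMeasurable ?_
  refine hφ.lt_top_of_lintegral_lt_top hB (hm.pow_const 2).ennreal_ofReal
    (f := fun x ↦ ENNReal.ofReal Q * ENNReal.ofReal (‖h.grad x‖ ^ 2)) (fun y hy ↦ ?_) ?_
  · rw [← ENNReal.ofReal_mul (zero_le_one.trans hφ.one_le)]
    exact ENNReal.ofReal_le_ofReal (hφ.sq_partialDeriv_le h i hy)
  · rw [lintegral_const_mul' _ _ ENNReal.ofReal_ne_top]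
    exact ENNReal.mul_lt_top ENNReal.ofReal_lt_top h.lintegral_grad

lemma integral_mul_fderiv_eq (hφ : IsControlledOn φ B c Q) (h : H1 n M)
    {η : EuclideanSpace ℝ (Fin n) → ℝ} (hη : ContDiff ℝ ∞ η) (hηc : HasCompactSupport η)
    (hηs : tsupport η ⊆ B) (i : Fin n) :
    ∫ y, h.toFun (φ.symm y) * fderiv ℝ η y (EuclideanSpace.basisFun (Fin n) ℝ i) =
      -∫ y, h.partialDeriv φ i y * η y :=
  h.isWeakGradient φ hφ.mem_atlas η hη hηc (hηs.trans hφ.subset_target) _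

end IsControlledOn

end LowerBound

/-! ### The lower bound for the min-max value. -/

section LowerBound

variable {n : ℕ} {M : Type*} [TopologicalSpace M] [ChartedSpace (EuclideanSpace ℝ (Fin n)) M]
  [IsManifold (𝓡 n) ∞ M]
  [RiemannianBundle (fun x : M ↦ TangentSpace (𝓡 n) x)]
  [IsContMDiffRiemannianBundle (𝓡 n) ∞ (EuclideanSpace ℝ (Fin n))
      (fun x : M ↦ TangentSpace (𝓡 n) x)]
  [MeasurableSpace M] [BorelSpace M]
  {φ : OpenPartialHomeomorph M (EuclideanSpace ℝ (Fin n))}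

namespace IsControlledOn

variable {p : EuclideanSpace ℝ (Fin n)} {r c Q : ℝ}

lemma lintegral_sq_sub_le {B : Set (EuclideanSpace ℝ (Fin n))} (hφ : IsControlledOn φ B c Q)
    (hB : MeasurableSet B) (h h' : H1 n M) :
    ∫⁻ y in B, ENNReal.ofReal ((h.toFun (φ.symm y) - h'.toFun (φ.symm y)) ^ 2) ≤
      (ENNReal.ofReal c)⁻¹ * h.distance h' ^ 2 := by
  have hc : ENNReal.ofReal c ≠ 0 := by simpa using hφ.pos
  rw [← ENNReal.mul_le_iff_le_inv hc ENNReal.ofReal_ne_top]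
  have hd : h.distance h' ^ 2 = ∫⁻ x, ENNReal.ofReal ((h.toFun x - h'.toFun x) ^ 2 +
      ‖h.grad x - h'.grad x‖ ^ 2) ∂(riemannianVolume n M) := by
    rw [H1.distance, ← ENNReal.rpow_natCast, ← ENNReal.rpow_mul]
    norm_num
  rw [hd]
  refine lintegral_coord_le hφ.mem_atlas hB hφ.subset_target
    (((hφ.aestronglyMeasurable_toFun h).sub
      (hφ.aestronglyMeasurable_toFun h')).pow 2).aemeasurable.ennreal_ofReal
    (fun y _ ↦ ENNReal.ofReal_le_ofReal ?_) hφ.le_density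
  exact le_add_of_nonneg_right (sq_nonneg _)

/-- The mean of `smoothStep ∘ u` on a coordinate ball is continuous in `u ∈ H¹`. -/
lemma continuous_integral_smoothStep (hφ : IsControlledOn φ (Metric.ball p (2 * r)) c Q)
    (hr : 0 < r) {X : Type*} [TopologicalSpace X] {h : X → H1 n M}
    (hh : ∀ s, Tendsto (fun t ↦ (h t).distance (h s)) (𝓝 s) (𝓝 0)) :
    Continuous fun t ↦ ∫ y in Metric.ball p r, smoothStep ((h t).toFun (φ.symm y)) := by
  set B := Metric.ball p r
  set B' := Metric.ball p (2 * r)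
  have hBB' : B ⊆ B' := Metric.ball_subset_ball (by linarith)
  have hB' : MeasurableSet B' := Metric.isOpen_ball.measurableSet
  have hfin : IsFiniteMeasure (volume.restrict B) := ⟨by simpa using measure_ball_lt_top⟩
  set V := volume.real B
  have hV : 0 < V := ENNReal.toReal_pos (Metric.measure_ball_pos volume p hr).ne'
    measure_ball_lt_top.ne
  obtain ⟨L, hL0, hL⟩ := exists_smoothStep_sub_le
  rw [continuous_iff_continuousAt]
  intro s
  set d : X → EuclideanSpace ℝ (Fin n) → ℝ := fun t y ↦
    (h t).toFun (φ.symm y) - (h s).toFun (φ.symm y)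
  have hd : ∀ t, MemLp (d t) 2 (volume.restrict B) := fun t ↦
    ((hφ.memLp_toFun hB' (h t)).sub (hφ.memLp_toFun hB' (h s))).mono_measure
      (Measure.restrict_mono hBB' le_rfl)
  set J : X → ℝ := fun t ↦ ∫ y in B, d t y ^ 2
  have hJ : Tendsto J (𝓝 s) (𝓝 0) := by
    have h1 : Tendsto (fun t ↦ (ENNReal.ofReal c)⁻¹ * (h t).distance (h s) ^ 2) (𝓝 s) (𝓝 0) := by
      have h2 := ENNReal.Tendsto.const_mul (a := (ENNReal.ofReal c)⁻¹)
        (ENNReal.Tendsto.pow (n := 2) (hh s)) (Or.inr (by simpa using hφ.pos))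
      simpa using h2
    have h3 : Tendsto (fun t ↦ ∫⁻ y in B, ENNReal.ofReal (d t y ^ 2)) (𝓝 s) (𝓝 0) :=
      tendsto_of_tendsto_of_tendsto_of_le_of_le tendsto_const_nhds h1 (fun _ ↦ zero_le)
        fun t ↦ (lintegral_mono_set hBB').trans (hφ.lintegral_sq_sub_le hB' (h t) (h s))
    have h4 := (ENNReal.tendsto_toReal ENNReal.zero_ne_top).comp h3
    refine h4.congr fun t ↦ ?_
    exact (integral_eq_lintegral_of_nonneg_ae (.of_forall fun _ ↦ sq_nonneg _)
      ((hd t).aestronglyMeasurable.pow 2)).symm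
  have hsi : ∀ t, Integrable (fun y ↦ smoothStep ((h t).toFun (φ.symm y)))
      (volume.restrict B) := fun t ↦ by
    refine Integrable.of_bound (contDiff_smoothStep.continuous.comp_aestronglyMeasurable
      ((hφ.aestronglyMeasurable_toFun (h t)).mono_measure (Measure.restrict_mono hBB' le_rfl)))
      (1 / 2) (.of_forall fun x ↦ abs_smoothStep_le _)
  have hbound : ∀ t, |(∫ y in B, smoothStep ((h t).toFun (φ.symm y))) -
      ∫ y in B, smoothStep ((h s).toFun (φ.symm y))| ≤ L * (V * √(V⁻¹ * J t)) := by
    intro t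
    have hi : Integrable (fun y ↦ |d t y|) (volume.restrict B) :=
      ((hd t).integrable one_le_two).abs
    -- Cauchy–Schwarz, in the form of Jensen's inequality for the uniform probability density `V⁻¹`
    -- on `B`.
    have hcs : (∫ y in B, V⁻¹ * |d t y|) ^ 2 ≤ ∫ y in B, V⁻¹ * |d t y| ^ 2 := by
      refine sq_integral_mul_le (η := fun _ ↦ V⁻¹) (fun _ ↦ by positivity) ?_ (hi.const_mul _) ?_
      · rw [integral_const, measureReal_restrict_apply_univ, smul_eq_mul]
        exact mul_inv_cancel₀ hV.ne'
      · simp_rw [sq_abs]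
        exact (hd t).integrable_sq.const_mul _
    simp_rw [sq_abs] at hcs
    rw [integral_const_mul, integral_const_mul] at hcs
    have h5 : ∫ y in B, |d t y| ≤ V * √(V⁻¹ * J t) := by
      rw [← div_le_iff₀' hV, div_eq_inv_mul]
      exact Real.le_sqrt_of_sq_le hcs
    rw [← integral_sub (hsi t) (hsi s)]
    calc _ ≤ ∫ y in B, |smoothStep ((h t).toFun (φ.symm y)) -
              smoothStep ((h s).toFun (φ.symm y))| := abs_integral_le_integral_abs
      _ ≤ ∫ y in B, L * |d t y| := integral_mono ((hsi t).sub (hsi s)).abs (hi.const_mul L)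
          fun y ↦ hL _ _
      _ = L * ∫ y in B, |d t y| := integral_const_mul _ _
      _ ≤ _ := by gcongr
  have hlim : Tendsto (fun t ↦ L * (V * √(V⁻¹ * J t))) (𝓝 s) (𝓝 0) := by
    have := (((hJ.const_mul V⁻¹).sqrt).const_mul V).const_mul L
    simpa using this
  rw [ContinuousAt, tendsto_iff_dist_tendsto_zero]
  exact squeeze_zero (fun _ ↦ dist_nonneg) hbound hlim

/-- A path in `Γ` contains a function balanced between the two wells. -/
lemma exists_integral_eq_zero (hφ : IsControlledOn φ (Metric.ball p (2 * r)) c Q)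
    (hr : 0 < r) {h : unitInterval → H1 n M} (hh : h ∈ paths n M) :
    ∃ t, ∫ y in Metric.ball p r, smoothStep ((h t).toFun (φ.symm y)) = 0 := by
  set B := Metric.ball p r
  obtain ⟨hc, h0, h1⟩ := hh
  have hsub : B ⊆ φ.target := (Metric.ball_subset_ball (by linarith)).trans hφ.subset_target
  have h0' : ∀ᵐ y ∂volume.restrict B, (h 0).toFun (φ.symm y) = -1 :=
    ae_mono (Measure.restrict_mono hsub le_rfl) (ae_comp_symm hφ.mem_atlas h0)
  have h1' : ∀ᵐ y ∂volume.restrict B, (h 1).toFun (φ.symm y) = 1 :=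
    ae_mono (Measure.restrict_mono hsub le_rfl) (ae_comp_symm hφ.mem_atlas h1)
  -- Intermediate value theorem on the connected interval: `smoothStep` is negative at `-1` and
  -- positive at `1`.
  have := mem_range_of_exists_le_of_exists_ge (c := 0)
    (hφ.continuous_integral_smoothStep hr hc) ⟨0, ?_⟩ ⟨1, ?_⟩
  · exact this
  · refine integral_nonpos_of_ae ?_
    filter_upwards [h0'] with y hy
    rw [hy, smoothStep_of_le (by norm_num)]
    norm_num
  · refine integral_nonneg_of_ae ?_
    filter_upwards [h1'] with y hy
    rw [hy, smoothStep_of_ge (by norm_num)]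
    norm_num

/-- Passage from the intrinsic energy to the coordinate one. The condition `κ ≤ a` handles the
potential; `κ n Q ≤ 1/2` handles the gradient, because each of the `n` squared partial derivatives
is at most `Q |∇u|²`. -/
lemma ofReal_mul_le_energy (hφ : IsControlledOn φ (Metric.ball p (2 * r)) c Q) (hr : 0 < r)
    {W : ℝ → ℝ} {a ε : ℝ} (ha : ∀ s, a * plateau s ≤ W s) (hε : 0 < ε) {κ : ℝ}
    (hκ : 0 ≤ κ) (hκa : κ ≤ a) (hκQ : κ * (n * Q) ≤ 1 / 2) (h : H1 n M) :
    ENNReal.ofReal (c * (κ * (ε * (∑ i, ∫ y in Metric.ball p (2 * r), h.partialDeriv φ i y ^ 2) +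
      1 / ε * ∫ y in Metric.ball p r, plateau (h.toFun (φ.symm y))))) ≤ energy W ε h := by
  set B := Metric.ball p r
  set B' := Metric.ball p (2 * r)
  have hBB' : B ⊆ B' := Metric.ball_subset_ball (by linarith)
  have hB : MeasurableSet B := Metric.isOpen_ball.measurableSet
  have hB' : MeasurableSet B' := Metric.isOpen_ball.measurableSet
  have hfin : IsFiniteMeasure (volume.restrict B') := ⟨by simpa using measure_ball_lt_top⟩
  -- The potential term lives on the smaller ball and the gradient term on the larger one. The
  -- indicator puts both under one integral over `B'`.
  set P : EuclideanSpace ℝ (Fin n) → ℝ := B.indicator fun y ↦ plateau (h.toFun (φ.symm y))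
  have hPle : ∀ y, P y ≤ plateau (h.toFun (φ.symm y)) :=
    fun y ↦ indicator_le_self' (fun _ _ ↦ plateau_nonneg _) y
  have hP0 : ∀ y, 0 ≤ P y := fun y ↦ indicator_nonneg (fun _ _ ↦ plateau_nonneg _) y
  have hPi : Integrable P (volume.restrict B') := by
    refine Integrable.indicator ?_ hB
    exact Integrable.of_bound (continuous_plateau.comp_aestronglyMeasurable
      (hφ.aestronglyMeasurable_toFun h)) 1 (.of_forall fun y ↦ by
        rw [Real.norm_eq_abs, abs_of_nonneg (plateau_nonneg _)]; exact plateau_le_one _)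
  have hGi : ∀ i, Integrable (fun y ↦ h.partialDeriv φ i y ^ 2) (volume.restrict B') := fun i ↦
    (hφ.memLp_partialDeriv hB' h i).integrable_sq
  set K : EuclideanSpace ℝ (Fin n) → ℝ := fun y ↦
    κ * (ε * (∑ i, h.partialDeriv φ i y ^ 2) + 1 / ε * P y)
  have hKi : Integrable K (volume.restrict B') :=
    (((integrable_finsetSum _ fun i _ ↦ hGi i).const_mul ε).add (hPi.const_mul (1 / ε))).const_mul κ
  have hK0 : ∀ y, 0 ≤ K y := fun y ↦ by
    have := hP0 y
    have : 0 ≤ ∑ i, h.partialDeriv φ i y ^ 2 := Finset.sum_nonneg fun _ _ ↦ sq_nonneg _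
    positivity
  have hKint : ∫ y in B', K y = κ * (ε * (∑ i, ∫ y in B', h.partialDeriv φ i y ^ 2) +
      1 / ε * ∫ y in B, plateau (h.toFun (φ.symm y))) := by
    rw [integral_const_mul, integral_add ((integrable_finsetSum _ fun i _ ↦ hGi i).const_mul ε)
      (hPi.const_mul (1 / ε)), integral_const_mul, integral_const_mul,
      integral_finsetSum _ fun i _ ↦ hGi i, setIntegral_indicator hB,
      inter_eq_self_of_subset_right hBB']
  rw [← hKint, ENNReal.ofReal_mul hφ.pos.le,
    ofReal_integral_eq_lintegral_ofReal hKi (.of_forall hK0)]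
  refine lintegral_coord_le hφ.mem_atlas hB' hφ.subset_target hKi.aemeasurable.ennreal_ofReal
    (fun y hy ↦ ENNReal.ofReal_le_ofReal ?_) hφ.le_density
  set g := ‖h.grad (φ.symm y)‖ ^ 2
  have hg : 0 ≤ g := sq_nonneg _
  have h1 : ∑ i, h.partialDeriv φ i y ^ 2 ≤ n * Q * g := by
    calc _ ≤ ∑ i : Fin n, Q * g := Finset.sum_le_sum fun i _ ↦ hφ.sq_partialDeriv_le h i hy
      _ = _ := by simp [mul_assoc]
  have h2 : κ * P y ≤ W (h.toFun (φ.symm y)) :=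
    (mul_le_mul hκa (hPle y) (hP0 y) (hκ.trans hκa)).trans (ha _)
  calc K y = ε * (κ * ∑ i, h.partialDeriv φ i y ^ 2) + κ * P y / ε := by
        simp only [K]
        ring
    _ ≤ ε * (κ * (n * Q * g)) + W (h.toFun (φ.symm y)) / ε := by gcongr
    _ = ε * (κ * (n * Q) * g) + W (h.toFun (φ.symm y)) / ε := by ring
    _ ≤ ε * (1 / 2 * g) + W (h.toFun (φ.symm y)) / ε := by gcongr
    _ = _ := by ring

end IsControlledOn

variable (n M) in
theorem exists_le_minMaxValue [Nonempty M] {W : ℝ → ℝ} (hW : IsDoubleWell W) :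
    ∃ c : ℝ, 0 < c ∧ ∀ ε, 0 < ε → ε ≤ 1 → ENNReal.ofReal c ≤ minMaxValue n M W ε := by
  obtain ⟨φ, p, r, c, Q, hr, hφ⟩ := exists_isControlledOn_ball n M
  obtain ⟨a, ha0, ha⟩ := hW.exists_mul_plateau_le
  obtain ⟨c₀, hc₀, hlow⟩ := exists_le_energy_of_integral_eq_zero p hr
  have hQ : 0 < Q := one_pos.trans_le hφ.one_le
  have hc := hφ.pos
  -- `n + 1` in place of `n` keeps the denominator positive for every `n`.
  set κ := min a (1 / (2 * ((n + 1) * Q)))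
  have hκ : 0 < κ := lt_min ha0 (by positivity)
  have hκQ : κ * (n * Q) ≤ 1 / 2 := by
    calc κ * (n * Q) ≤ 1 / (2 * ((n + 1) * Q)) * ((n + 1) * Q) := by
          gcongr
          · exact min_le_right _ _
          · linarith
      _ = 1 / 2 := by field_simp
  refine ⟨c * (κ * c₀), by positivity, fun ε hε hε1 ↦ le_iInf₂ fun h hh ↦ ?_⟩
  obtain ⟨t, ht⟩ := hφ.exists_integral_eq_zero hr hh
  refine le_iSup_of_le t (le_trans (ENNReal.ofReal_le_ofReal ?_)
    (hφ.ofReal_mul_le_energy hr ha hε hκ.le (min_le_left _ _) hκQ (h t)))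
  have hB' : MeasurableSet (Metric.ball p (2 * r)) := Metric.isOpen_ball.measurableSet
  gcongr
  exact hlow ε _ (fun i ↦ (h t).partialDeriv φ i) hε hε1 (hφ.memLp_toFun hB' (h t))
    (hφ.memLp_partialDeriv hB' (h t))
    (fun η h1 h2 h3 i ↦ hφ.integral_mul_fderiv_eq (h t) h1 h2 h3 i) ht

end LowerBound

/-! ### Volume of Euclidean spherical shells. -/

section Shell

/-- Shells are measured by the squared radius, which is smooth at the centre. With radii `b ≤ a`,
`aⁿ - bⁿ ≤ n aⁿ⁻¹ (a - b) ≤ n aⁿ⁻² (a² - b²)`, which for `n ≥ 2` is linear in the difference of the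
squares, even near the centre. -/
lemma volume_shell_le {n : ℕ} (hn : 2 ≤ n) (p : EuclideanSpace ℝ (Fin n)) {R s t : ℝ}
    (hR : 0 ≤ R) (hst : s ≤ t) (ht : t ≤ R ^ 2) :
    volume {y : EuclideanSpace ℝ (Fin n) | s ≤ ‖y - p‖ ^ 2 ∧ ‖y - p‖ ^ 2 ≤ t} ≤
      ENNReal.ofReal (n * R ^ (n - 2) * (t - s)) *
        volume (Metric.ball (0 : EuclideanSpace ℝ (Fin n)) 1) := by
  have : Nontrivial (EuclideanSpace ℝ (Fin n)) :=
    Module.nontrivial_of_finrank_pos (R := ℝ) (by simp; omega)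
  rcases lt_or_ge t 0 with h0 | h0
  · have h : {y : EuclideanSpace ℝ (Fin n) | s ≤ ‖y - p‖ ^ 2 ∧ ‖y - p‖ ^ 2 ≤ t} = ∅ :=
      eq_empty_iff_forall_notMem.2 fun y hy ↦ by linarith [hy.2, sq_nonneg ‖y - p‖]
    rw [h, measure_empty]
    exact zero_le
  -- A negative lower level imposes no condition on `y`, but its square root would be meaningless as
  -- a radius.
  set s' := max s 0
  have hs' : 0 ≤ s' := le_max_right _ _
  have hs't : s' ≤ t := max_le hst h0
  have hsub : {y : EuclideanSpace ℝ (Fin n) | s ≤ ‖y - p‖ ^ 2 ∧ ‖y - p‖ ^ 2 ≤ t} ⊆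
      Metric.closedBall p √t \ Metric.ball p √s' := by
    rintro y ⟨h1, h2⟩
    refine ⟨?_, ?_⟩
    · rw [mem_closedBall_iff_norm]
      exact Real.le_sqrt_of_sq_le h2
    · rw [mem_ball_iff_norm, not_lt, Real.sqrt_le_left (norm_nonneg _)]
      exact max_le h1 (sq_nonneg _)
  refine (measure_mono hsub).trans ?_
  rw [measure_sdiff ((Metric.ball_subset_ball (Real.sqrt_le_sqrt hs't)).trans
    Metric.ball_subset_closedBall) Metric.isOpen_ball.measurableSet.nullMeasurableSet
    measure_ball_lt_top.ne, Measure.addHaar_closedBall _ _ (Real.sqrt_nonneg _),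
    Measure.addHaar_ball _ _ (Real.sqrt_nonneg _),
    ← ENNReal.sub_mul (fun _ _ ↦ measure_ball_lt_top.ne), ← ENNReal.ofReal_sub _ (by positivity)]
  gcongr
  simp only [finrank_euclideanSpace, Fintype.card_fin]
  set a := √t
  set b := √s'
  have ha : 0 ≤ a := Real.sqrt_nonneg _
  have hb : 0 ≤ b := Real.sqrt_nonneg _
  have hba : b ≤ a := Real.sqrt_le_sqrt hs't
  have haR : a ≤ R := Real.sqrt_le_left hR |>.2 ht
  have ha2 : a ^ 2 = t := Real.sq_sqrt h0
  have hb2 : b ^ 2 = s' := Real.sq_sqrt hs'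
  calc a ^ n - b ^ n ≤ |a ^ n - b ^ n| := le_abs_self _
    _ ≤ |a - b| * n * max |a| |b| ^ (n - 1) := abs_pow_sub_pow_le a b n
    _ = (a - b) * n * (a ^ (n - 2) * a) := by
        rw [abs_of_nonneg (sub_nonneg.2 hba), abs_of_nonneg ha, abs_of_nonneg hb,
          max_eq_left hba, ← pow_succ]
        congr 2
        omega
    _ = n * a ^ (n - 2) * ((a - b) * a) := by ring
    _ ≤ n * R ^ (n - 2) * ((a - b) * (a + b)) := by
        gcongr
        linarith
    _ = n * R ^ (n - 2) * (t - s') := by rw [← ha2, ← hb2]; ring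
    _ ≤ n * R ^ (n - 2) * (t - s) := by
        gcongr
        exact le_max_left _ _

end Shell

/-! ### Sweeping out a neighborhood of a point. -/

section Sweep

variable {n : ℕ} {M : Type*} [TopologicalSpace M] [ChartedSpace (EuclideanSpace ℝ (Fin n)) M]
  [IsManifold (𝓡 n) ∞ M]
  [RiemannianBundle (fun x : M ↦ TangentSpace (𝓡 n) x)]
  [IsContMDiffRiemannianBundle (𝓡 n) ∞ (EuclideanSpace ℝ (Fin n))
      (fun x : M ↦ TangentSpace (𝓡 n) x)]
  [MeasurableSpace M] [BorelSpace M]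

/-- Near every point there is a smooth function whose sublevel sets sweep out a neighborhood of
the point, with a linear bound for the volume between two level sets. -/
lemma exists_sweep_function [T2Space M] (hn : 2 ≤ n) (x₀ : M) :
    ∃ ρ : M → ℝ, ContMDiff (𝓡 n) 𝓘(ℝ, ℝ) ∞ ρ ∧ (∀ x, 0 ≤ ρ x) ∧ {x | ρ x ≤ 1} ∈ 𝓝 x₀ ∧
      ∃ C : ℝ, 0 ≤ C ∧ ∀ a b, a ≤ b → b ≤ 2 →
        riemannianVolume n M {x | a ≤ ρ x ∧ ρ x ≤ b} ≤ ENNReal.ofReal (C * (b - a)) := by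
  set φ := chartAt (EuclideanSpace ℝ (Fin n)) x₀
  have hφ : φ ∈ atlas (EuclideanSpace ℝ (Fin n)) M := chart_mem_atlas _ x₀
  have hx₀ : x₀ ∈ φ.source := mem_chart_source _ x₀
  set p := φ x₀
  obtain ⟨R, hR, hball⟩ := Metric.nhds_basis_closedBall.mem_iff.1
    (φ.open_target.mem_nhds (φ.map_source hx₀))
  set r := R / 3
  have hr : 0 < r := by positivity
  have hp : extChartAt (𝓡 n) x₀ x₀ = p := rfl
  let f : SmoothBumpFunction (𝓡 n) x₀ :=
    { rIn := 2 * r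
      rOut := R
      rIn_pos := by positivity
      rIn_lt_rOut := by simp only [r]; linarith
      closedBall_subset := by
        rw [hp]
        simpa using hball }
  set q : M → ℝ := fun x ↦ ‖φ x - p‖ ^ 2 / r ^ 2
  have hq0 : ∀ x, 0 ≤ q x := fun x ↦ by positivity
  -- Interpolation between `q` and the constant `4`. On the coordinate ball of radius `2 r` the bump
  -- is `1` and `ρ = q`. Elsewhere in the chart `q ≥ 4`, so `ρ ≥ 4`, and off the chart `ρ = 4`. Thus
  -- `{ρ ≤ 2}` lies where `ρ` is the scaled squared radius.
  set ρ : M → ℝ := fun x ↦ 4 + f x • (q x - 4)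
  have hf0 : ∀ x, 0 ≤ f x := fun x ↦ f.nonneg
  have hf1 : ∀ x, f x ≤ 1 := fun x ↦ f.le_one
  have hnear : ∀ x ∈ φ.source, ‖φ x - p‖ ≤ 2 * r → ρ x = q x := by
    intro x hx hxr
    have : f x = 1 := f.one_of_dist_le hx (by rw [dist_eq_norm]; exact hxr)
    simp only [ρ, this, one_smul]
    ring
  have hlow : ∀ x, ρ x ≤ 2 → x ∈ φ.source ∧ ‖φ x - p‖ ≤ 2 * r := by
    intro x hx
    simp only [ρ, smul_eq_mul] at hx
    refine ⟨f.support_subset_source fun h0 ↦ ?_, ?_⟩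
    · rw [h0] at hx
      linarith
    · by_contra! hlt
      have : 4 ≤ q x := by
        rw [le_div_iff₀ (by positivity)]
        nlinarith
      nlinarith [mul_nonneg (hf0 x) (sub_nonneg.2 this)]
  have hsmooth : ContMDiff (𝓡 n) 𝓘(ℝ, ℝ) ∞ ρ := by
    have h1 : ContMDiffOn (𝓡 n) (𝓡 n) ∞ φ φ.source :=
      contMDiffOn_of_mem_maximalAtlas (IsManifold.subset_maximalAtlas hφ)
    have h2 : ContDiff ℝ ∞ fun y : EuclideanSpace ℝ (Fin n) ↦ ‖y - p‖ ^ 2 / r ^ 2 - 4 :=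
      (((contDiff_id.sub contDiff_const).norm_sq ℝ).div_const _).sub contDiff_const
    exact contMDiff_const.add (f.contMDiff_smul (h2.contMDiff.comp_contMDiffOn h1))
  refine ⟨ρ, hsmooth, fun x ↦ ?_, ?_, ?_⟩
  · simp only [ρ, smul_eq_mul]
    nlinarith [mul_nonneg (hf0 x) (hq0 x), hf1 x]
  · have h1 : ContinuousAt (fun x ↦ ‖φ x - p‖) x₀ :=
      ((φ.continuousAt hx₀).sub continuousAt_const).norm
    have h2 : ∀ᶠ x in 𝓝 x₀, ‖φ x - p‖ < r := h1.eventually_lt_const (by simpa [p] using hr)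
    filter_upwards [h2, φ.open_source.mem_nhds hx₀] with x hx hxs
    rw [hnear x hxs (by linarith)]
    refine div_le_one_of_le₀ ?_ (by positivity)
    gcongr
  · have hK : Metric.closedBall p (2 * r) ⊆ φ.target :=
      (Metric.closedBall_subset_closedBall (by simp only [r]; linarith)).trans hball
    obtain ⟨D, hD⟩ := (isCompact_closedBall p (2 * r)).exists_bound_of_continuousOn
      ((continuousOn_chartDensity hφ).mono hK)
    have hD0 : 0 ≤ D := (norm_nonneg _).trans (hD p (Metric.mem_closedBall_self (by positivity)))
    set v₁ := volume (Metric.ball (0 : EuclideanSpace ℝ (Fin n)) 1)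
    have hv₁ : v₁ ≠ ⊤ := measure_ball_lt_top.ne
    refine ⟨D * (n * (2 * r) ^ (n - 2) * r ^ 2 * v₁.toReal), by positivity, fun a b hab hb ↦ ?_⟩
    have hS : MeasurableSet {x | a ≤ ρ x ∧ ρ x ≤ b} :=
      ((isClosed_le continuous_const hsmooth.continuous).inter
        (isClosed_le hsmooth.continuous continuous_const)).measurableSet
    refine (riemannianVolume_le_mul_volume hφ hS (fun x hx ↦ (hlow x (hx.2.trans hb)).1)
      (K := {y | a * r ^ 2 ≤ ‖y - p‖ ^ 2 ∧ ‖y - p‖ ^ 2 ≤ b * r ^ 2}) (fun x hx ↦ ?_)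
      (C := D) ?_).trans ?_
    · obtain ⟨h1, h2⟩ := hlow x (hx.2.trans hb)
      have h3 := hnear x h1 h2
      have hx' := hx
      rw [mem_ofPred_eq, h3] at hx'
      simp only [q] at hx'
      rw [le_div_iff₀ (by positivity), div_le_iff₀ (by positivity)] at hx'
      exact hx'
    · rintro y ⟨hy, hyS⟩
      have h1 := (hlow _ (hyS.2.trans hb)).2
      rw [φ.right_inv hy] at h1
      exact (le_abs_self _).trans (hD y (mem_closedBall_iff_norm.2 h1))
    · calc _ ≤ ENNReal.ofReal D * (ENNReal.ofReal (n * (2 * r) ^ (n - 2) *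
              (b * r ^ 2 - a * r ^ 2)) * v₁) := by
            gcongr
            exact volume_shell_le hn p (by positivity) (by gcongr) (by nlinarith)
        _ = _ := by
            rw [← ENNReal.ofReal_toReal hv₁, ← ENNReal.ofReal_mul' ENNReal.toReal_nonneg,
              ← ENNReal.ofReal_mul hD0, ENNReal.toReal_ofReal ENNReal.toReal_nonneg]
            congr 1
            ring

end Sweep

/-! ### Riemannian gradients of smooth functions and of their compositions. -/

section Gradient

variable {n : ℕ} {M : Type*} [TopologicalSpace M] [ChartedSpace (EuclideanSpace ℝ (Fin n)) M]
  [RiemannianBundle (fun x : M ↦ TangentSpace (𝓡 n) x)]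
  {φ : OpenPartialHomeomorph M (EuclideanSpace ℝ (Fin n))} {ι : Type*} [Fintype ι]

instance completeSpace_tangentSpace (x : M) : CompleteSpace (TangentSpace (𝓡 n) x) :=
  FiniteDimensional.complete ℝ _

variable (n) in
/-- The Riemannian gradient of a function. -/
def riemannianGradient (f : M → ℝ) (x : M) : TangentSpace (𝓡 n) x :=
  (InnerProductSpace.toDual ℝ (TangentSpace (𝓡 n) x)).symm (mfderiv (𝓡 n) 𝓘(ℝ, ℝ) f x)

lemma inner_riemannianGradient (f : M → ℝ) (x : M) (v : TangentSpace (𝓡 n) x) :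
    inner ℝ (riemannianGradient n f x) v = mfderiv (𝓡 n) 𝓘(ℝ, ℝ) f x v :=
  InnerProductSpace.toDual_symm_apply

open scoped Classical in
/-- The partial derivative `∂F/∂z_k`. -/
def coordDeriv (F : (ι → ℝ) → ℝ) (k : ι) (z : ι → ℝ) : ℝ :=
  fderiv ℝ F z (Pi.single k 1)

variable (n) in
/-- The gradient of `x ↦ F (ρ₁ x, …, ρ_N x)`, by the chain rule. -/
def compGradient (ρ : ι → M → ℝ) (F : (ι → ℝ) → ℝ) (x : M) : TangentSpace (𝓡 n) x :=
  ∑ k, coordDeriv F k (fun j ↦ ρ j x) • riemannianGradient n (ρ k) x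

variable [IsManifold (𝓡 n) ∞ M]

lemma contDiffAt_comp_symm (hφ : φ ∈ atlas (EuclideanSpace ℝ (Fin n)) M) {f : M → ℝ}
    (hf : ContMDiff (𝓡 n) 𝓘(ℝ, ℝ) ∞ f) {y : EuclideanSpace ℝ (Fin n)} (hy : y ∈ φ.target) :
    ContDiffAt ℝ ∞ (f ∘ φ.symm) y :=
  (hf.contMDiffAt.comp y (contMDiffAt_symm_of_mem_maximalAtlas
    (IsManifold.subset_maximalAtlas hφ) hy)).contDiffAt

lemma inner_riemannianGradient_coordVector (hφ : φ ∈ atlas (EuclideanSpace ℝ (Fin n)) M)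
    {f : M → ℝ} (hf : ContMDiff (𝓡 n) 𝓘(ℝ, ℝ) ∞ f) {y : EuclideanSpace ℝ (Fin n)}
    (hy : y ∈ φ.target) (v : EuclideanSpace ℝ (Fin n)) :
    inner ℝ (riemannianGradient n f (φ.symm y)) (coordVector φ v y) =
      fderiv ℝ (f ∘ φ.symm) y v := by
  rw [inner_riemannianGradient]
  have h := mfderiv_comp y (hf.mdifferentiableAt (by simp)) (mdifferentiableAt_symm hφ hy)
  rw [mfderiv_eq_fderiv] at h
  exact (DFunLike.congr_fun h v).symm

lemma contDiffAt_comp_pi (hφ : φ ∈ atlas (EuclideanSpace ℝ (Fin n)) M) {ρ : ι → M → ℝ}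
    (hρ : ∀ k, ContMDiff (𝓡 n) 𝓘(ℝ, ℝ) ∞ (ρ k)) {F : (ι → ℝ) → ℝ} (hF : ContDiff ℝ 1 F)
    {y : EuclideanSpace ℝ (Fin n)} (hy : y ∈ φ.target) :
    ContDiffAt ℝ 1 (fun z ↦ F (fun j ↦ ρ j (φ.symm z))) y := by
  refine hF.contDiffAt.comp y (contDiffAt_pi.2 fun j ↦ ?_)
  exact (contDiffAt_comp_symm hφ (hρ j) hy).of_le (by norm_num)

lemma inner_compGradient_coordVector (hφ : φ ∈ atlas (EuclideanSpace ℝ (Fin n)) M)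
    {ρ : ι → M → ℝ} (hρ : ∀ k, ContMDiff (𝓡 n) 𝓘(ℝ, ℝ) ∞ (ρ k)) {F : (ι → ℝ) → ℝ}
    (hF : ContDiff ℝ 1 F) {y : EuclideanSpace ℝ (Fin n)} (hy : y ∈ φ.target)
    (v : EuclideanSpace ℝ (Fin n)) :
    inner ℝ (compGradient n ρ F (φ.symm y)) (coordVector φ v y) =
      fderiv ℝ (fun z ↦ F (fun j ↦ ρ j (φ.symm z))) y v := by
  classical
  have h1 : HasFDerivAt (fun z ↦ fun j ↦ ρ j (φ.symm z))
      (ContinuousLinearMap.pi fun j ↦ fderiv ℝ (ρ j ∘ φ.symm) y) y :=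
    hasFDerivAt_pi.2 fun j ↦
      ((contDiffAt_comp_symm hφ (hρ j) hy).differentiableAt (by simp)).hasFDerivAt
  have h2 := ((hF.differentiable (by simp) (fun j ↦ ρ j (φ.symm y))).hasFDerivAt.comp y h1).fderiv
  have h3 : fderiv ℝ (fun z ↦ F (fun j ↦ ρ j (φ.symm z))) y v =
      fderiv ℝ F (fun j ↦ ρ j (φ.symm y)) (fun j ↦ fderiv ℝ (ρ j ∘ φ.symm) y v) :=
    DFunLike.congr_fun h2 v
  rw [h3, compGradient, sum_inner]
  have h4 : (fun j ↦ fderiv ℝ (ρ j ∘ φ.symm) y v) =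
      ∑ k, (fderiv ℝ (ρ k ∘ φ.symm) y v) • (Pi.single k 1 : ι → ℝ) := by
    ext j
    simp [Finset.sum_apply, Pi.single_apply]
  rw [h4, map_sum]
  refine Finset.sum_congr rfl fun k _ ↦ ?_
  rw [real_inner_smul_left, inner_riemannianGradient_coordVector hφ (hρ k) hy, map_smul,
    smul_eq_mul, mul_comm, coordDeriv]

/-- The product is continuous on the whole space although `g` is so only on `U`, because it vanishes
near every point outside the support of `η`. -/
lemma integrable_mul_of_tsupport_subset {U : Set (EuclideanSpace ℝ (Fin n))}
    (hU : IsOpen U) {g η : EuclideanSpace ℝ (Fin n) → ℝ} (hg : ContinuousOn g U)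
    (hη : Continuous η) (hηc : HasCompactSupport η) (hηU : tsupport η ⊆ U) :
    Integrable fun y ↦ g y * η y := by
  refine Continuous.integrable_of_hasCompactSupport ?_ hηc.mul_left
  refine continuous_of_tsupport fun y hy ↦ ?_
  exact (hg.continuousAt (hU.mem_nhds (hηU (tsupport_mul_subset_right hy)))).mul hη.continuousAt

/-- The classical gradient is a weak one: integration by parts in a single chart, without boundary
terms because the test function has compact support in the target. -/
lemma isWeakGradient_compGradient {ρ : ι → M → ℝ}
    (hρ : ∀ k, ContMDiff (𝓡 n) 𝓘(ℝ, ℝ) ∞ (ρ k)) {F : (ι → ℝ) → ℝ} (hF : ContDiff ℝ 1 F) :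
    IsWeakGradient (fun x ↦ F (fun j ↦ ρ j x)) (compGradient n ρ F) := by
  intro φ hφ η hη hηc hηs v
  set g : EuclideanSpace ℝ (Fin n) → ℝ := fun z ↦ F (fun j ↦ ρ j (φ.symm z))
  have hg : ContDiffOn ℝ 1 g φ.target := fun y hy ↦
    (contDiffAt_comp_pi hφ hρ hF hy).contDiffWithinAt
  have hg' : ContinuousOn (fun y ↦ fderiv ℝ g y v) φ.target :=
    (hg.continuousOn_fderiv_of_isOpen φ.open_target le_rfl).clm_apply continuousOn_const
  have hη' : Continuous fun y ↦ fderiv ℝ η y v :=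
    (hη.continuous_fderiv (by simp)).clm_apply continuous_const
  have hsupp' : tsupport (fun y ↦ fderiv ℝ η y v) ⊆ tsupport η :=
    tsupport_fderiv_apply_subset ℝ v
  have h := integral_mul_fderiv_eq_neg_fderiv_mul_of_integrable (μ := volume) (f := g) (g := η)
    (v := v)
    (integrable_mul_of_tsupport_subset φ.open_target hg' hη.continuous hηc hηs)
    (integrable_mul_of_tsupport_subset φ.open_target hg.continuousOn hη'
      (hηc.fderiv_apply ℝ v) (hsupp'.trans hηs))
    (integrable_mul_of_tsupport_subset φ.open_target hg.continuousOn hη.continuous hηc hηs)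
    (fun y hy ↦ (contDiffAt_comp_pi hφ hρ hF (hηs hy)).differentiableAt (by simp))
    (fun y _ ↦ hη.differentiable (by simp) y)
  rw [h]
  congr 2 with y
  by_cases hy : y ∈ φ.target
  · rw [inner_compGradient_coordVector hφ hρ hF hy]
  · rw [image_eq_zero_of_notMem_tsupport (fun h ↦ hy (hηs h)), mul_zero, mul_zero]

variable [IsContMDiffRiemannianBundle (𝓡 n) ∞ (EuclideanSpace ℝ (Fin n))
      (fun x : M ↦ TangentSpace (𝓡 n) x)]

/-- Near a point the differential factors through a trivialization of bounded norm, so `‖G‖² =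
df(G)` is at most a constant times `‖G‖`. Compactness makes the local bounds global, and continuity
of the gradient as a section is not needed. -/
lemma exists_norm_riemannianGradient_le [CompactSpace M] {f : M → ℝ}
    (hf : ContMDiff (𝓡 n) 𝓘(ℝ, ℝ) ∞ f) :
    ∃ C : ℝ, 0 ≤ C ∧ ∀ x, ‖riemannianGradient n f x‖ ≤ C := by
  have hloc : ∀ x : M, ∃ C : ℝ, 0 ≤ C ∧ ∀ᶠ z in 𝓝 x, ‖riemannianGradient n f z‖ ≤ C := by
    intro x
    have : IsContinuousRiemannianBundle (EuclideanSpace ℝ (Fin n))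
        (fun x : M ↦ TangentSpace (𝓡 n) x) := by
      obtain ⟨g, hg, h⟩ := IsContMDiffRiemannianBundle.exists_contMDiff (IB := 𝓡 n) (n := ∞)
        (F := EuclideanSpace ℝ (Fin n)) (E := fun x : M ↦ TangentSpace (𝓡 n) x)
      exact ⟨g, hg.continuous, h⟩
    obtain ⟨C, hC, hCx⟩ := eventually_norm_trivializationAt_lt (EuclideanSpace ℝ (Fin n))
      (fun x : M ↦ TangentSpace (𝓡 n) x) x
    set φ := chartAt (EuclideanSpace ℝ (Fin n)) x
    have hφ : φ ∈ atlas (EuclideanSpace ℝ (Fin n)) M := chart_mem_atlas _ x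
    have hx : x ∈ φ.source := mem_chart_source _ x
    have hcont : ContinuousAt (fun z ↦ ‖fderiv ℝ (f ∘ φ.symm) (φ z)‖) x := by
      have h1 : ContinuousAt (fderiv ℝ (f ∘ φ.symm)) (φ x) :=
        ((contDiffAt_comp_symm hφ hf (φ.map_source hx)).fderiv_right (m := 0)
          (by norm_num)).continuousAt
      exact (h1.comp (φ.continuousAt hx)).norm
    refine ⟨(‖fderiv ℝ (f ∘ φ.symm) (φ x)‖ + 1) * C, by positivity, ?_⟩
    filter_upwards [hCx, φ.open_source.mem_nhds hx,
      hcont.eventually_lt_const (lt_add_one _)] with z hz hzs hzf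
    have key : ∀ v : TangentSpace (𝓡 n) z, mfderiv (𝓡 n) 𝓘(ℝ, ℝ) f z v =
        fderiv ℝ (f ∘ φ.symm) (φ z) ((trivializationAt (EuclideanSpace ℝ (Fin n))
          (fun x : M ↦ TangentSpace (𝓡 n) x) x).continuousLinearMapAt ℝ z v) := by
      intro v
      rw [TangentBundle.continuousLinearMapAt_trivializationAt hzs]
      have h1 : MDifferentiableAt (𝓡 n) 𝓘(ℝ, ℝ) (f ∘ φ.symm) (φ z) :=
        ((contDiffAt_comp_symm hφ hf (φ.map_source hzs)).differentiableAt
          (by simp)).mdifferentiableAt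
      have h2 : MDifferentiableAt (𝓡 n) (𝓡 n) φ z :=
        (contMDiffAt_of_mem_maximalAtlas (n := ∞) (IsManifold.subset_maximalAtlas hφ)
          hzs).mdifferentiableAt (by simp)
      have h3 := mfderiv_comp z h1 h2
      have h4 : (f ∘ φ.symm) ∘ φ =ᶠ[𝓝 z] f := by
        filter_upwards [φ.open_source.mem_nhds hzs] with w hw
        simp [φ.left_inv hw]
      rw [h4.mfderiv_eq, mfderiv_eq_fderiv] at h3
      exact DFunLike.congr_fun h3 v
    set G := riemannianGradient n f z
    set T := (trivializationAt (EuclideanSpace ℝ (Fin n))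
      (fun x : M ↦ TangentSpace (𝓡 n) x) x).continuousLinearMapAt ℝ z
    have hG : ‖G‖ * ‖G‖ ≤ (‖fderiv ℝ (f ∘ φ.symm) (φ x)‖ + 1) * C * ‖G‖ := by
      calc ‖G‖ * ‖G‖ = fderiv ℝ (f ∘ φ.symm) (φ z) (T G) := by
            rw [← real_inner_self_eq_norm_mul_norm, ← key]
            exact inner_riemannianGradient f z G
        _ ≤ ‖fderiv ℝ (f ∘ φ.symm) (φ z) (T G)‖ := Real.le_norm_self _
        _ ≤ ‖fderiv ℝ (f ∘ φ.symm) (φ z)‖ * ‖T G‖ := (fderiv ℝ (f ∘ φ.symm) (φ z)).le_opNorm _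
        _ ≤ ‖fderiv ℝ (f ∘ φ.symm) (φ z)‖ * (‖T‖ * ‖G‖) := by
            gcongr
            exact T.le_opNorm G
        _ ≤ (‖fderiv ℝ (f ∘ φ.symm) (φ x)‖ + 1) * (C * ‖G‖) := by gcongr
        _ = _ := by ring
    rcases (norm_nonneg G).eq_or_lt with h0 | h0
    · rw [← h0]
      positivity
    · exact le_of_mul_le_mul_right hG h0
  choose C hC0 hC using hloc
  obtain ⟨t, ht⟩ := CompactSpace.elim_nhds_subcover
    (fun x ↦ {z | ‖riemannianGradient n f z‖ ≤ C x}) hC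
  refine ⟨∑ x ∈ t, C x, Finset.sum_nonneg fun x _ ↦ hC0 x, fun z ↦ ?_⟩
  have hz : z ∈ ⋃ x ∈ t, {z | ‖riemannianGradient n f z‖ ≤ C x} := by rw [ht]; trivial
  obtain ⟨x, hx, hzx⟩ := mem_iUnion₂.1 hz
  exact hzx.trans (Finset.single_le_sum (fun x _ ↦ hC0 x) hx)

end Gradient

/-! ### Compositions as elements of `H¹(M)` and their continuous dependence on a parameter. -/

section Composition

variable {n : ℕ} {M : Type*} [TopologicalSpace M] [ChartedSpace (EuclideanSpace ℝ (Fin n)) M]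
  [RiemannianBundle (fun x : M ↦ TangentSpace (𝓡 n) x)]
  [IsManifold (𝓡 n) ∞ M]
  [IsContMDiffRiemannianBundle (𝓡 n) ∞ (EuclideanSpace ℝ (Fin n))
      (fun x : M ↦ TangentSpace (𝓡 n) x)]
  [CompactSpace M] [MeasurableSpace M] [BorelSpace M]
  {ι : Type*} [Fintype ι] {ρ : ι → M → ℝ}

lemma norm_compGradient_sub_le {Γ : ℝ} (hΓ : ∀ k x, ‖riemannianGradient n (ρ k) x‖ ≤ Γ)
    (F F' : (ι → ℝ) → ℝ) (x : M) :
    ‖compGradient n ρ F x - compGradient n ρ F' x‖ ≤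
      ∑ k, |coordDeriv F k (fun j ↦ ρ j x) - coordDeriv F' k (fun j ↦ ρ j x)| * Γ := by
  rw [compGradient, compGradient, ← Finset.sum_sub_distrib]
  refine (norm_sum_le _ _).trans (Finset.sum_le_sum fun k _ ↦ ?_)
  rw [← sub_smul, norm_smul, Real.norm_eq_abs]
  gcongr
  exact hΓ k x

lemma norm_compGradient_le {Γ : ℝ} (hΓ : ∀ k x, ‖riemannianGradient n (ρ k) x‖ ≤ Γ)
    (F : (ι → ℝ) → ℝ) (x : M) :
    ‖compGradient n ρ F x‖ ≤ ∑ k, |coordDeriv F k (fun j ↦ ρ j x)| * Γ := by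
  rw [compGradient]
  refine (norm_sum_le _ _).trans (Finset.sum_le_sum fun k _ ↦ ?_)
  rw [norm_smul, Real.norm_eq_abs]
  gcongr
  exact hΓ k x

lemma exists_norm_riemannianGradient_le_of_fintype
    (hρ : ∀ k, ContMDiff (𝓡 n) 𝓘(ℝ, ℝ) ∞ (ρ k)) :
    ∃ Γ : ℝ, 0 ≤ Γ ∧ ∀ k x, ‖riemannianGradient n (ρ k) x‖ ≤ Γ := by
  choose C hC0 hC using fun k ↦ exists_norm_riemannianGradient_le (hρ k)
  exact ⟨∑ k, C k, Finset.sum_nonneg fun k _ ↦ hC0 k, fun k x ↦ (hC k x).trans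
    (Finset.single_le_sum (fun k _ ↦ hC0 k) (Finset.mem_univ k))⟩

lemma continuous_coordDeriv {F : (ι → ℝ) → ℝ} (hF : ContDiff ℝ 1 F) (k : ι) :
    Continuous (coordDeriv F k) :=
  (hF.continuous_fderiv (by simp)).clm_apply continuous_const

/-- The function `x ↦ F (ρ₁ x, …, ρ_N x)` as an element of `H¹(M)`. -/
def H1.ofComp (ρ : ι → M → ℝ) (hρ : ∀ k, ContMDiff (𝓡 n) 𝓘(ℝ, ℝ) ∞ (ρ k))
    (F : (ι → ℝ) → ℝ) (hF : ContDiff ℝ 1 F) : H1 n M where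
  toFun x := F (fun j ↦ ρ j x)
  grad := compGradient n ρ F
  memLp := by
    have hc : Continuous fun x ↦ F (fun j ↦ ρ j x) :=
      hF.continuous.comp (continuous_pi fun j ↦ (hρ j).continuous)
    obtain ⟨C, hC⟩ := isCompact_univ.exists_bound_of_continuousOn hc.continuousOn
    exact MemLp.of_bound hc.aestronglyMeasurable C (.of_forall fun x ↦ hC x (mem_univ x))
  aemeasurable_grad φ hφ v := by
    refine ContinuousOn.aemeasurable ?_ φ.open_target.measurableSet
    have hg : ContDiffOn ℝ 1 (fun z ↦ F (fun j ↦ ρ j (φ.symm z))) φ.target := fun y hy ↦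
      (contDiffAt_comp_pi hφ hρ hF hy).contDiffWithinAt
    exact ((hg.continuousOn_fderiv_of_isOpen φ.open_target le_rfl).clm_apply
      continuousOn_const).congr fun y hy ↦ inner_compGradient_coordVector hφ hρ hF hy v
  lintegral_grad := by
    obtain ⟨Γ, hΓ0, hΓ⟩ := exists_norm_riemannianGradient_le_of_fintype hρ
    have hc : Continuous fun x ↦ ∑ k, |coordDeriv F k (fun j ↦ ρ j x)| * Γ :=
      continuous_finsetSum _ fun k _ ↦ (((continuous_coordDeriv hF k).comp
        (continuous_pi fun j ↦ (hρ j).continuous)).abs).mul continuous_const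
    obtain ⟨C, hC⟩ := isCompact_univ.exists_bound_of_continuousOn hc.continuousOn
    calc ∫⁻ x, ENNReal.ofReal (‖compGradient n ρ F x‖ ^ 2) ∂riemannianVolume n M
        ≤ ∫⁻ _, ENNReal.ofReal (C ^ 2) ∂riemannianVolume n M := by
          refine lintegral_mono fun x ↦ ENNReal.ofReal_le_ofReal ?_
          gcongr
          exact (norm_compGradient_le hΓ F x).trans ((le_abs_self _).trans (hC x (mem_univ x)))
      _ < ⊤ := by
          rw [lintegral_const]
          exact ENNReal.mul_lt_top ENNReal.ofReal_lt_top (measure_lt_top _ _)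
  isWeakGradient := isWeakGradient_compGradient hρ hF

/-- The integrand of the squared distance is dominated by a jointly continuous function `H` of `(t,
x)` that vanishes at `t = s`. Since `M` is compact, `H` becomes uniformly small, and the volume is
finite. -/
lemma tendsto_distance_ofComp (hρ : ∀ k, ContMDiff (𝓡 n) 𝓘(ℝ, ℝ) ∞ (ρ k))
    {Ψ : ℝ × (ι → ℝ) → ℝ} (hΨ : ContDiff ℝ 1 Ψ) (s : ℝ) :
    Tendsto (fun t ↦ (H1.ofComp ρ hρ (fun z ↦ Ψ (t, z)) (hΨ.comp (contDiff_prodMk_right t))).distance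
      (H1.ofComp ρ hρ (fun z ↦ Ψ (s, z)) (hΨ.comp (contDiff_prodMk_right s)))) (𝓝 s) (𝓝 0) := by
  classical
  obtain ⟨Γ, hΓ0, hΓ⟩ := exists_norm_riemannianGradient_le_of_fintype hρ
  set μ := riemannianVolume n M
  have hD : ∀ k, Continuous fun q : ℝ × (ι → ℝ) ↦ coordDeriv (fun z ↦ Ψ (q.1, z)) k q.2 := by
    intro k
    have h1 : ∀ q : ℝ × (ι → ℝ), coordDeriv (fun z ↦ Ψ (q.1, z)) k q.2 =
        fderiv ℝ Ψ q (0, Pi.single k 1) := by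
      intro q
      have h2 := HasFDerivAt.comp (g := Ψ) (f := fun z ↦ (q.1, z)) q.2
        (hΨ.differentiable (by simp) q).hasFDerivAt (hasFDerivAt_prodMk_right q.1 q.2)
      have h3 : fderiv ℝ (fun z ↦ Ψ (q.1, z)) q.2 = _ := h2.fderiv
      rw [coordDeriv, h3]
      simp
    simp_rw [h1]
    exact (hΨ.continuous_fderiv (by simp)).clm_apply continuous_const
  have hρc : Continuous fun x ↦ fun j ↦ ρ j x := continuous_pi fun j ↦ (hρ j).continuous
  set H : ℝ → M → ℝ := fun t x ↦ (Ψ (t, fun j ↦ ρ j x) - Ψ (s, fun j ↦ ρ j x)) ^ 2 +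
    (∑ k, |coordDeriv (fun z ↦ Ψ (t, z)) k (fun j ↦ ρ j x) -
      coordDeriv (fun z ↦ Ψ (s, z)) k (fun j ↦ ρ j x)| * Γ) ^ 2
  have hH : Continuous fun q : ℝ × M ↦ H q.1 q.2 := by
    have hΨc := hΨ.continuous
    have h1 : Continuous fun q : ℝ × M ↦ (q.1, fun j ↦ ρ j q.2) :=
      continuous_fst.prodMk (hρc.comp continuous_snd)
    have h2 : Continuous fun q : ℝ × M ↦ (s, fun j ↦ ρ j q.2) :=
      continuous_const.prodMk (hρc.comp continuous_snd)
    refine (((hΨc.comp h1).sub (hΨc.comp h2)).pow 2).add (Continuous.pow ?_ 2)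
    exact continuous_finsetSum _ fun k _ ↦
      ((((hD k).comp h1).sub ((hD k).comp h2)).abs).mul continuous_const
  have hHs : ∀ x, H s x = 0 := fun x ↦ by simp [H]
  have hsmall : ∀ δ > 0, ∀ᶠ t in 𝓝 s, ∀ x, H t x < δ := by
    intro δ hδ
    have := isCompact_univ.eventually_forall_of_forall_eventually (x₀ := s)
      (P := fun t x ↦ H t x < δ) (K := (univ : Set M)) fun x _ ↦
        hH.continuousAt.eventually_lt_const (by simpa [hHs] using hδ)
    simpa using this
  have hint : Tendsto (fun t ↦ ∫⁻ x, ENNReal.ofReal (H t x) ∂μ) (𝓝 s) (𝓝 0) := by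
    rw [ENNReal.tendsto_nhds_zero]
    intro e he
    have h1 : Tendsto (fun δ : ℝ ↦ ENNReal.ofReal δ * μ univ) (𝓝[>] 0) (𝓝 0) := by
      have h2 : Tendsto (fun δ : ℝ ↦ ENNReal.ofReal δ) (𝓝[>] 0) (𝓝 0) := by
        have := (ENNReal.continuous_ofReal.tendsto 0).mono_left
          (nhdsWithin_le_nhds (s := Ioi (0 : ℝ)))
        simpa using this
      have := ENNReal.Tendsto.mul_const (b := μ univ) h2 (Or.inr (measure_ne_top _ _))
      simpa using this
    obtain ⟨δ, hδe, hδ⟩ := ((ENNReal.tendsto_nhds_zero.1 h1 e he).and self_mem_nhdsWithin).exists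
    filter_upwards [hsmall δ hδ] with t ht
    calc ∫⁻ x, ENNReal.ofReal (H t x) ∂μ ≤ ∫⁻ _, ENNReal.ofReal δ ∂μ :=
          lintegral_mono fun x ↦ ENNReal.ofReal_le_ofReal (ht x).le
      _ = ENNReal.ofReal δ * μ univ := lintegral_const _
      _ ≤ e := hδe
  have hrpow : Tendsto (fun t ↦ (∫⁻ x, ENNReal.ofReal (H t x) ∂μ) ^ (1 / 2 : ℝ)) (𝓝 s) (𝓝 0) := by
    have := (ENNReal.continuous_rpow_const (y := 1 / 2)).tendsto 0 |>.comp hint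
    simpa [Function.comp_def] using this
  refine tendsto_of_tendsto_of_tendsto_of_le_of_le tendsto_const_nhds hrpow (fun _ ↦ zero_le)
    fun t ↦ ?_
  refine ENNReal.rpow_le_rpow (lintegral_mono fun x ↦ ENNReal.ofReal_le_ofReal ?_) (by norm_num)
  refine add_le_add le_rfl ?_
  gcongr
  exact norm_compGradient_sub_le hΓ _ _ x

end Composition

/-! ### The profile of the sweepout and its derivatives. -/

section Profile

variable {ι : Type*} [Fintype ι]

/-- The profile of the optimal sweepout: it decreases from `1` to `-1` as the coordinate functions
`z_k` increase past `2 t`, with transition layers of width `ε`. -/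
def sweepProfile (ε : ℝ) (q : ℝ × (ι → ℝ)) : ℝ :=
  1 - 2 * ∏ k, (1 / 2 - smoothStep ((2 * q.1 - q.2 k) / ε - 1 / 2))

lemma contDiff_sweepProfile (ε : ℝ) : ContDiff ℝ 1 (sweepProfile (ι := ι) ε) := by
  refine contDiff_const.sub (contDiff_const.mul (contDiff_prod fun k _ ↦ contDiff_const.sub
    (contDiff_smoothStep.comp ?_)))
  fun_prop

lemma half_sub_smoothStep_nonneg (s : ℝ) : 0 ≤ 1 / 2 - smoothStep s := by
  linarith [(abs_le.1 (abs_smoothStep_le s)).2]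

lemma half_sub_smoothStep_le_one (s : ℝ) : 1 / 2 - smoothStep s ≤ 1 := by
  linarith [(abs_le.1 (abs_smoothStep_le s)).1]

lemma sweepProfile_mem_Icc (ε : ℝ) (q : ℝ × (ι → ℝ)) : sweepProfile ε q ∈ Icc (-1 : ℝ) 1 := by
  have h0 : 0 ≤ ∏ k, (1 / 2 - smoothStep ((2 * q.1 - q.2 k) / ε - 1 / 2)) :=
    Finset.prod_nonneg fun k _ ↦ half_sub_smoothStep_nonneg _
  have h1 : ∏ k, (1 / 2 - smoothStep ((2 * q.1 - q.2 k) / ε - 1 / 2)) ≤ 1 :=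
    Finset.prod_le_one (fun k _ ↦ half_sub_smoothStep_nonneg _)
      fun k _ ↦ half_sub_smoothStep_le_one _
  constructor <;> rw [sweepProfile] <;> linarith

variable {ε t : ℝ} {z : ι → ℝ}

lemma sweepProfile_eq_neg_one (hε : 0 < ε) (h : ∀ k, 2 * t ≤ z k) :
    sweepProfile ε (t, z) = -1 := by
  rw [sweepProfile, Finset.prod_eq_one fun k _ ↦ ?_]
  · norm_num
  · have : (2 * t - z k) / ε ≤ 0 := div_nonpos_of_nonpos_of_nonneg (by linarith [h k]) hε.le
    rw [smoothStep_of_le (by linarith)]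
    norm_num

lemma sweepProfile_eq_one (hε : 0 < ε) (k : ι) (h : z k ≤ 2 * t - ε) :
    sweepProfile ε (t, z) = 1 := by
  rw [sweepProfile, Finset.prod_eq_zero (Finset.mem_univ k)]
  · norm_num
  · have : 1 ≤ (2 * t - z k) / ε := by
      rw [one_le_div hε]
      linarith
    rw [smoothStep_of_ge (by linarith)]
    norm_num

/-- The layer `2 t - ε ≤ z k ≤ 2 t` corresponds exactly to the arguments in `[-1/2, 1/2]`. The
strict inequality is what `deriv_smoothStep_eq_zero` requires. -/
lemma half_lt_abs_of_notMem (hε : 0 < ε) {k : ι} (h : ¬(2 * t - ε ≤ z k ∧ z k ≤ 2 * t)) :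
    1 / 2 < |(2 * t - z k) / ε - 1 / 2| := by
  rw [lt_abs]
  by_cases h1 : 2 * t - ε ≤ z k
  · right
    have : (2 * t - z k) / ε < 0 := div_neg_of_neg_of_pos
      (by linarith [not_le.1 (not_and.1 h h1)]) hε
    linarith
  · left
    have : 1 < (2 * t - z k) / ε := by
      rw [one_lt_div hε]
      linarith
    linarith

lemma sweepProfile_eq_one_or_neg_one (hε : 0 < ε)
    (h : ∀ k, ¬(2 * t - ε ≤ z k ∧ z k ≤ 2 * t)) :
    sweepProfile ε (t, z) = 1 ∨ sweepProfile ε (t, z) = -1 := by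
  by_cases h1 : ∃ k, z k ≤ 2 * t - ε
  · obtain ⟨k, hk⟩ := h1
    exact .inl (sweepProfile_eq_one hε k hk)
  · push Not at h1
    exact .inr (sweepProfile_eq_neg_one hε fun k ↦ (not_le.1 (not_and.1 (h k) (h1 k).le)).le)

/-- Along the line in direction `k` only one factor of the product varies, with inner derivative `-1
/ ε`. The other factors lie in `[0, 1]`. -/
lemma abs_coordDeriv_sweepProfile_le (hε : 0 < ε) (k : ι) :
    |coordDeriv (fun z ↦ sweepProfile ε (t, z)) k z| ≤
      2 / ε * |deriv smoothStep ((2 * t - z k) / ε - 1 / 2)| := by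
  classical
  set F : (ι → ℝ) → ℝ := fun z ↦ sweepProfile ε (t, z)
  have hF : ContDiff ℝ 1 F := (contDiff_sweepProfile ε).comp (contDiff_prodMk_right t)
  set A := ∏ j ∈ Finset.univ.erase k, (1 / 2 - smoothStep ((2 * t - z j) / ε - 1 / 2))
  set e : ι → ℝ := Pi.single k 1
  have hline : ∀ s : ℝ, F (z + s • e) =
      1 - 2 * ((1 / 2 - smoothStep ((2 * t - (z k + s)) / ε - 1 / 2)) * A) := by
    intro s
    simp only [F, sweepProfile]
    rw [← Finset.mul_prod_erase _ _ (Finset.mem_univ k)]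
    congr 3
    · simp [e]
    · refine Finset.prod_congr rfl fun j hj ↦ ?_
      simp [e, Finset.ne_of_mem_erase hj]
  have h1 : HasDerivAt (fun s : ℝ ↦ F (z + s • e)) (coordDeriv F k z) 0 := by
    have hc : HasDerivAt (fun s : ℝ ↦ z + s • e) e 0 := by
      have := ((hasDerivAt_id (0 : ℝ)).smul_const e).const_add z
      simpa using this
    have h2 : HasFDerivAt F (fderiv ℝ F z) (z + (0 : ℝ) • e) := by
      rw [zero_smul, add_zero]
      exact (hF.differentiable (by simp) z).hasFDerivAt
    exact h2.comp_hasDerivAt 0 hc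
  have h2 : HasDerivAt (fun s : ℝ ↦ F (z + s • e))
      (-(2 / ε) * A * deriv smoothStep ((2 * t - z k) / ε - 1 / 2)) 0 := by
    have h3 : HasDerivAt (fun s : ℝ ↦ (2 * t - (z k + s)) / ε - 1 / 2) (-1 / ε) 0 :=
      ((((hasDerivAt_id (0 : ℝ)).const_add (z k)).const_sub (2 * t)).div_const ε).sub_const _
    have h4 : HasDerivAt smoothStep (deriv smoothStep ((2 * t - z k) / ε - 1 / 2))
        ((2 * t - (z k + 0)) / ε - 1 / 2) := by
      rw [add_zero]
      exact (contDiff_smoothStep.differentiable (by simp) _).hasDerivAt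
    have h5 := ((((h4.comp (0 : ℝ) h3).const_sub (1 / 2)).mul_const A).const_mul 2).const_sub 1
    simp_rw [hline]
    exact h5.congr_deriv (by ring)
  have hA0 : 0 ≤ A := Finset.prod_nonneg fun j _ ↦ half_sub_smoothStep_nonneg _
  have hA1 : A ≤ 1 := Finset.prod_le_one (fun j _ ↦ half_sub_smoothStep_nonneg _)
    fun j _ ↦ half_sub_smoothStep_le_one _
  rw [h1.unique h2, abs_mul, abs_mul, abs_neg, abs_of_pos (show 0 < 2 / ε by positivity),
    abs_of_nonneg hA0]
  gcongr
  exact mul_le_of_le_one_right (by positivity) hA1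

end Profile

/-! ### The upper bound for the min-max value. -/

section UpperBound

variable {n : ℕ} {M : Type*} [TopologicalSpace M] [ChartedSpace (EuclideanSpace ℝ (Fin n)) M]
  [RiemannianBundle (fun x : M ↦ TangentSpace (𝓡 n) x)]
  [IsManifold (𝓡 n) ∞ M]
  [IsContMDiffRiemannianBundle (𝓡 n) ∞ (EuclideanSpace ℝ (Fin n))
      (fun x : M ↦ TangentSpace (𝓡 n) x)]
  [CompactSpace M] [MeasurableSpace M] [BorelSpace M]
  {ι : Type*} [Fintype ι] {ρ : ι → M → ℝ}

/-- The path of functions with transition layers near the level sets `{ρ_k = 2 t}`. -/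
def sweepPath (hρ : ∀ k, ContMDiff (𝓡 n) 𝓘(ℝ, ℝ) ∞ (ρ k)) (ε t : ℝ) : H1 n M :=
  H1.ofComp ρ hρ (fun z ↦ sweepProfile ε (t, z))
    ((contDiff_sweepProfile ε).comp (contDiff_prodMk_right t))

/-- At `t = 0` every `ρ k ≥ 0 = 2 t`, giving `-1`. At `t = 1` every point has some `ρ k ≤ 1 ≤ 2 -
ε`, giving `1`. The level `2 t` rather than `t` leaves room for the layer, and this is where `ε ≤ 1`
enters. -/
lemma sweepPath_mem_paths (hρ : ∀ k, ContMDiff (𝓡 n) 𝓘(ℝ, ℝ) ∞ (ρ k)) (h0 : ∀ k x, 0 ≤ ρ k x)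
    (h1 : ∀ x, ∃ k, ρ k x ≤ 1) {ε : ℝ} (hε : 0 < ε) (hε1 : ε ≤ 1) :
    (fun t : unitInterval ↦ sweepPath hρ ε t) ∈ paths n M := by
  refine ⟨fun s ↦ ?_, .of_forall fun x ↦ ?_, .of_forall fun x ↦ ?_⟩
  · exact (tendsto_distance_ofComp hρ (contDiff_sweepProfile ε) s).comp
      (continuous_subtype_val.tendsto s)
  · exact sweepProfile_eq_neg_one hε fun k ↦ by simpa using h0 k x
  · obtain ⟨k, hk⟩ := h1 x
    refine sweepProfile_eq_one hε k ?_
    change ρ k x ≤ 2 * (1 : ℝ) - ε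
    linarith

lemma energy_sweepPath_le (hρ : ∀ k, ContMDiff (𝓡 n) 𝓘(ℝ, ℝ) ∞ (ρ k)) {Cρ : ι → ℝ}
    (hCρ : ∀ k, 0 ≤ Cρ k) (hvol : ∀ k a b, a ≤ b → b ≤ 2 →
      riemannianVolume n M {x | a ≤ ρ k x ∧ ρ k x ≤ b} ≤ ENNReal.ofReal (Cρ k * (b - a)))
    {Γ : ℝ} (hΓ0 : 0 ≤ Γ) (hΓ : ∀ k x, ‖riemannianGradient n (ρ k) x‖ ≤ Γ)
    {W : ℝ → ℝ} (hW1 : W 1 = 0) (hW1' : W (-1) = 0) {w : ℝ} (hw0 : 0 ≤ w)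
    (hw : ∀ s ∈ Icc (-1 : ℝ) 1, W s ≤ w) {L : ℝ}
    (hL : ∀ s, |deriv smoothStep s| ≤ L) {ε t : ℝ} (hε : 0 < ε) (ht : t ≤ 1) :
    energy W ε (sweepPath hρ ε t) ≤
      ENNReal.ofReal (((Fintype.card ι * (2 * L * Γ)) ^ 2 / 2 + w) * ∑ k, Cρ k) := by
  classical
  -- In a layer the gradient is at most `N (2 L Γ) / ε` with `N` the number of functions `ρ k`, so
  -- the energy density is at most `C₁ / ε`.
  set C₁ := (Fintype.card ι * (2 * L * Γ)) ^ 2 / 2 + w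
  have hC₁ : 0 ≤ C₁ := by positivity
  set A : ι → Set M := fun k ↦ {x | 2 * t - ε ≤ ρ k x ∧ ρ k x ≤ 2 * t}
  have hA : ∀ k, MeasurableSet (A k) := fun k ↦
    ((isClosed_le continuous_const (hρ k).continuous).inter
      (isClosed_le (hρ k).continuous continuous_const)).measurableSet
  -- Outside all layers the gradient vanishes and the function is `1` or `-1`, so the density is
  -- zero. Where layers overlap, the sum of indicators only overestimates.
  have hpt : ∀ x, ENNReal.ofReal (ε * (‖(sweepPath hρ ε t).grad x‖ ^ 2 / 2) +
      W ((sweepPath hρ ε t).toFun x) / ε) ≤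
        ∑ k, (A k).indicator (fun _ ↦ ENNReal.ofReal (C₁ / ε)) x := by
    intro x
    have hg := norm_compGradient_le hΓ (fun z ↦ sweepProfile ε (t, z)) x
    set g := ‖(sweepPath hρ ε t).grad x‖
    have hg0 : 0 ≤ g := norm_nonneg _
    have hcd := fun k ↦ abs_coordDeriv_sweepProfile_le (t := t) (z := fun j ↦ ρ j x) hε k
    by_cases hx : ∃ k, x ∈ A k
    · obtain ⟨k, hk⟩ := hx
      refine le_trans (ENNReal.ofReal_le_ofReal ?_) (le_trans (le_of_eq
        (indicator_of_mem hk (fun _ ↦ ENNReal.ofReal (C₁ / ε))).symm)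
        (Finset.single_le_sum (f := fun k ↦ (A k).indicator (fun _ ↦ ENNReal.ofReal (C₁ / ε)) x)
          (fun _ _ ↦ zero_le) (Finset.mem_univ k)))
      have hg1 : g ≤ Fintype.card ι * (2 * L * Γ) / ε := by
        calc g ≤ ∑ k, |coordDeriv (fun z ↦ sweepProfile ε (t, z)) k (fun j ↦ ρ j x)| * Γ := hg
          _ ≤ ∑ _k : ι, 2 / ε * L * Γ := by
            refine Finset.sum_le_sum fun k _ ↦ ?_
            gcongr
            refine (hcd k).trans ?_
            gcongr
            exact hL _
          _ = _ := by
            rw [Finset.sum_const, Finset.card_univ, nsmul_eq_mul]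
            ring
      have hW := hw _ (sweepProfile_mem_Icc ε (t, fun j ↦ ρ j x))
      calc ε * (g ^ 2 / 2) + W (sweepProfile ε (t, fun j ↦ ρ j x)) / ε
          ≤ ε * ((Fintype.card ι * (2 * L * Γ) / ε) ^ 2 / 2) + w / ε := by gcongr
        _ = C₁ / ε := by
            simp only [C₁]
            field_simp
    · push Not at hx
      have hg1 : g ≤ 0 := by
        refine hg.trans (Finset.sum_nonpos fun k _ ↦ ?_)
        have h1 := hcd k
        rw [deriv_smoothStep_eq_zero (half_lt_abs_of_notMem (z := fun j ↦ ρ j x) hε (hx k)),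
          abs_zero, mul_zero] at h1
        exact mul_nonpos_of_nonpos_of_nonneg h1 hΓ0
      have hW : W ((sweepPath hρ ε t).toFun x) = 0 := by
        rcases sweepProfile_eq_one_or_neg_one (z := fun j ↦ ρ j x) hε hx with h | h
        · exact (congrArg W h).trans hW1
        · exact (congrArg W h).trans hW1'
      rw [hW, le_antisymm hg1 hg0]
      simp
  calc energy W ε (sweepPath hρ ε t)
      ≤ ∫⁻ x, ∑ k, (A k).indicator (fun _ ↦ ENNReal.ofReal (C₁ / ε)) x
          ∂riemannianVolume n M := lintegral_mono hpt
    _ = ∑ k, ENNReal.ofReal (C₁ / ε) * riemannianVolume n M (A k) := by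
        rw [lintegral_finsetSum _ fun k _ ↦ measurable_const.indicator (hA k)]
        refine Finset.sum_congr rfl fun k _ ↦ ?_
        rw [lintegral_indicator_const (hA k)]
    _ ≤ ∑ k, ENNReal.ofReal (C₁ * Cρ k) := by
        refine Finset.sum_le_sum fun k _ ↦ ?_
        have h1 := hvol k (2 * t - ε) (2 * t) (by linarith) (by linarith)
        calc _ ≤ ENNReal.ofReal (C₁ / ε) * ENNReal.ofReal (Cρ k * (2 * t - (2 * t - ε))) := by
              gcongr
          _ = _ := by
              rw [← ENNReal.ofReal_mul (by positivity)]
              congr 1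
              field_simp
              ring
    _ = _ := by
        rw [← ENNReal.ofReal_sum_of_nonneg fun k _ ↦ mul_nonneg hC₁ (hCρ k), Finset.mul_sum]

variable (n M) in
-- Compactness extracts finitely many sweep functions whose sets `{ρ ≤ 1}` cover `M`. None of the
-- resulting constants depends on `ε`.
theorem exists_minMaxValue_le [T2Space M] (hn : 2 ≤ n) {W : ℝ → ℝ} (hW : IsDoubleWell W) :
    ∃ C : ℝ, ∀ ε, 0 < ε → ε ≤ 1 → minMaxValue n M W ε ≤ ENNReal.ofReal C := by
  choose ρ hρ h0 h1 Cρ hCρ hvol using exists_sweep_function (M := M) hn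
  obtain ⟨T, hT⟩ := CompactSpace.elim_nhds_subcover _ h1
  have hρT : ∀ k : T, ContMDiff (𝓡 n) 𝓘(ℝ, ℝ) ∞ (ρ k) := fun k ↦ hρ k
  obtain ⟨Γ, hΓ0, hΓ⟩ := exists_norm_riemannianGradient_le_of_fintype hρT
  obtain ⟨w, hw⟩ := (isCompact_Icc (a := (-1 : ℝ)) (b := 1)).exists_bound_of_continuousOn
    hW.contDiff.continuous.continuousOn
  have hw0 : 0 ≤ w := (norm_nonneg _).trans (hw 0 (by norm_num))
  obtain ⟨L, hL0, hL⟩ := exists_deriv_smoothStep_le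
  have hL' : ∀ s, |deriv smoothStep s| ≤ L := fun s ↦ (hL s).trans
    (mul_le_of_le_one_right hL0 (pow_le_one₀ (plateau_nonneg s) (plateau_le_one s)))
  have hcover : ∀ x, ∃ k : T, ρ k x ≤ 1 := by
    intro x
    have hx : x ∈ ⋃ k ∈ T, {x | ρ k x ≤ 1} := by rw [hT]; trivial
    obtain ⟨k, hk, hkx⟩ := mem_iUnion₂.1 hx
    exact ⟨⟨k, hk⟩, hkx⟩
  refine ⟨((Fintype.card T * (2 * L * Γ)) ^ 2 / 2 + w) * ∑ k : T, Cρ k,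
    fun ε hε hε1 ↦ (iInf₂_le _ (sweepPath_mem_paths hρT (fun k ↦ h0 k)
      hcover hε hε1)).trans (iSup_le fun t ↦ ?_)⟩
  exact energy_sweepPath_le hρT (fun k ↦ hCρ k) (fun k ↦ hvol k) hΓ0 hΓ hW.zero_one hW.zero_neg_one
    hw0 (fun s hs ↦ (le_abs_self _).trans (hw s hs)) hL' hε t.2.2

end UpperBound

end PhaseTransition

end

/-! ### Conclusion: both bounds hold for `0 < ε ≤ 1`, hence eventually as `ε → 0⁺`. -/

theorem mainTheorem5 (n : ℕ) (hn : 3 ≤ n)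
    (M : Type*) [TopologicalSpace M] [T2Space M] [CompactSpace M] [Nonempty M]
    [ChartedSpace (EuclideanSpace ℝ (Fin n)) M] [IsManifold (𝓡 n) ∞ M]
    [RiemannianBundle (fun x : M ↦ TangentSpace (𝓡 n) x)]
    [IsContMDiffRiemannianBundle (𝓡 n) ∞ (EuclideanSpace ℝ (Fin n))
      (fun x : M ↦ TangentSpace (𝓡 n) x)]
    [MeasurableSpace M] [BorelSpace M]
    (W : ℝ → ℝ) (hW : PhaseTransition.IsDoubleWell W) :
    0 < liminf (fun ε : ℝ ↦ PhaseTransition.minMaxValue n M W ε) (𝓝[>] 0) ∧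
    liminf (fun ε : ℝ ↦ PhaseTransition.minMaxValue n M W ε) (𝓝[>] 0) ≤
      limsup (fun ε : ℝ ↦ PhaseTransition.minMaxValue n M W ε) (𝓝[>] 0) ∧
    limsup (fun ε : ℝ ↦ PhaseTransition.minMaxValue n M W ε) (𝓝[>] 0) < ⊤ := by
  obtain ⟨c, hc, hlow⟩ := PhaseTransition.exists_le_minMaxValue n M hW
  obtain ⟨C, hup⟩ := PhaseTransition.exists_minMaxValue_le n M (by omega) hW
  have hev : ∀ᶠ ε : ℝ in 𝓝[>] 0, 0 < ε ∧ ε ≤ 1 :=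
    Ioc_mem_nhdsGT one_pos
  refine ⟨?_, liminf_le_limsup, ?_⟩
  · refine (ENNReal.ofReal_pos.2 hc).trans_le (le_liminf_of_le (by isBoundedDefault) ?_)
    filter_upwards [hev] with ε hε using hlow ε hε.1 hε.2
  · refine (limsup_le_of_le (by isBoundedDefault) ?_).trans_lt (ENNReal.ofReal_lt_top (r := C))
    filter_upwards [hev] with ε hε using hup ε hε.1 hε.2
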